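/- Let $H$ be a complex separable infinite-dimensional Hilbert space; "ideal" means two-sided ideal of $B(H)$. Let $s(X)=\langle s_1(X),s_2(X),\dots\rangle$ be the sequence of $s$-numbers of $X\in B(H)$, $s_{n}(X)=\inf\{\|X-F\| : \operatorname{rank}F< n\}$ (for compact $X$: the eigenvalues of $|X|$ in nonincreasing order, with multiplicity). Let $c_o^*$ be the set of real sequences decreasing (not necessarily strictly) to $0$, and let $\ell_1^*$ be the set of nonincreasing nonnegative summable sequences. The characteristic set of an ideal $I$ is $\Sigma(I)=\{s(X) : X\in I\}\cap c_o^*$; an ideal of compact operators is determined by its characteristic set. For $\eta\in\ell_1^*$ let $\eta_{a_\infty}:=\big\langle \frac1n\sum_{j=n+1}^\infty\eta_j\big\rangle_{n\ge1}$. For an ideal $I\ne\{0\}$, the pre-arithmetic mean at infinity ${}_{a_\infty}I$ and the arithmetic mean at infinity $I_{a_\infty}$ are the ideals of compact operators with characteristic sets $$\Sigma({}_{a_\infty}I)=\{\xi\in\ell_1^* : \xi_{a_\infty}\in\Sigma(I)\},\qquad \Sigma(I_{a_\infty})=\{\xi\in c_o^* : \xi=O(\eta_{a_\infty})\text{ for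 some }\eta\in\Sigma(I)\cap\ell_1^*\}.$$ The ideal $I$ is called am-$\infty$ closed if $I={}_{a_\infty}(I_{a_\infty})$, and am-$\infty$ stable if $I={}_{a_\infty}I$. Put $$I_{-\infty}:=\bigcup\{J : J\subset I,\ J\text{ an am-}\infty\text{ closed ideal}\}.$$ **Theorem.** Let $I\neq\{0\}$ be a countably generated ideal. Then $I_{-\infty}={}_{a_\infty}I$, and this is the largest am-$\infty$ closed ideal contained in $I$. Consequently, $I$ is am-$\infty$ closed if and only if it is am-$\infty$ stable. -/

import Mathlib

open Filter Topology Asymptotics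

noncomputable section

namespace OperatorIdeal

/-! Sequences `⟨ξ₁, ξ₂, …⟩` are functions `ξ : ℕ → ℝ` with `ξ n` standing for the term of
(one-based) index `n + 1`. -/

/-- `c₀*`: the nonincreasing real sequences converging to `0` (hence nonnegative). -/
def c0Star : Set (ℕ → ℝ) :=
  {ξ | Antitone ξ ∧ Tendsto ξ atTop (𝓝 0)}

/-- `ℓ₁*`: the nonincreasing nonnegative summable sequences; this is the characteristic set of the
trace class. -/
def l1Star : Set (ℕ → ℝ) :=
  {ξ | Antitone ξ ∧ (∀ n, 0 ≤ ξ n) ∧ Summable ξ}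

/-- The arithmetic mean at infinity of a summable sequence: its term of one-based index `n` is
`(1 / n) * ∑_{j ≥ n + 1} η_j`. -/
def seqAmInfty (η : ℕ → ℝ) : ℕ → ℝ :=
  fun k => (∑' j : ℕ, η (j + (k + 1))) / ((k : ℝ) + 1)

variable {H : Type*} [NormedAddCommGroup H] [InnerProductSpace ℂ H]

/-- The sequence of `s`-numbers (singular numbers) of a bounded operator on a Hilbert space: the
term of one-based index `n + 1` is the distance from `X` to the operators of rank at most `n`. For a
compact operator these are the eigenvalues of `|X|` in nonincreasing order, with multiplicity. -/
def sNumbers (X : H →L[ℂ] H) : ℕ → ℝ :=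
  fun n => ⨅ F : {F : H →L[ℂ] H // LinearMap.rank (F : H →ₗ[ℂ] H) ≤ (n : Cardinal)},
    ‖X - (F : H →L[ℂ] H)‖

/-- The characteristic set `Σ(I)` of a two-sided ideal of `B(H)`: the sequences `s(X)`, `X ∈ I`,
that lie in `c₀*` (all of them do when `I` consists of compact operators). -/
def charSet (I : TwoSidedIdeal (H →L[ℂ] H)) : Set (ℕ → ℝ) :=
  {ξ | ξ ∈ c0Star ∧ ∃ X ∈ I, sNumbers X = ξ}

/-- The inverse of the Calkin correspondence: the ideal generated by the operators whose `s`-number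
sequence belongs to `S`. If `S ⊆ c₀*` is a hereditary cone invariant under ampliations, this is the
unique ideal of compact operators with characteristic set `S`. -/
def idealOfCharSet (S : Set (ℕ → ℝ)) : TwoSidedIdeal (H →L[ℂ] H) :=
  TwoSidedIdeal.span {X | sNumbers X ∈ S}

/-- The pre-arithmetic mean at infinity of `I`: the ideal with characteristic set
`{ξ ∈ ℓ₁* | ξ_{a∞} ∈ Σ(I)}`. -/
def preAmInfty (I : TwoSidedIdeal (H →L[ℂ] H)) : TwoSidedIdeal (H →L[ℂ] H) :=
  idealOfCharSet {ξ | ξ ∈ l1Star ∧ seqAmInfty ξ ∈ charSet I}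

/-- The arithmetic mean at infinity of `I`: the ideal with characteristic set
`{ξ ∈ c₀* | ξ = O(η_{a∞}) for some η ∈ Σ(I ∩ L₁)}`, where `Σ(I ∩ L₁) = Σ(I) ∩ ℓ₁*`. -/
def amInfty (I : TwoSidedIdeal (H →L[ℂ] H)) : TwoSidedIdeal (H →L[ℂ] H) :=
  idealOfCharSet {ξ | ξ ∈ c0Star ∧ ∃ η ∈ charSet I ∩ l1Star, ξ =O[atTop] seqAmInfty η}

/-- The am-∞ closure of `I`: the pre-arithmetic mean at infinity of the arithmetic mean at infinity
of `I`. -/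
def amInftyClosure (I : TwoSidedIdeal (H →L[ℂ] H)) : TwoSidedIdeal (H →L[ℂ] H) :=
  preAmInfty (amInfty I)

/-- `I` is am-∞ closed if it equals its am-∞ closure. -/
def IsAmInftyClosed (I : TwoSidedIdeal (H →L[ℂ] H)) : Prop :=
  I = amInftyClosure I

/-- `I` is am-∞ stable if it equals its pre-arithmetic mean at infinity. -/
def IsAmInftyStable (I : TwoSidedIdeal (H →L[ℂ] H)) : Prop :=
  I = preAmInfty I

/-- `I_{-∞}`: the union of all the am-∞ closed ideals contained in `I`. -/
def amInftyLower (I : TwoSidedIdeal (H →L[ℂ] H)) : Set (H →L[ℂ] H) :=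
  ⋃ J ∈ {J : TwoSidedIdeal (H →L[ℂ] H) | J ≤ I ∧ IsAmInftyClosed J}, (J : Set (H →L[ℂ] H))

/-- `I` is generated, as a two-sided ideal, by a countable set of operators. -/
def IsCountablyGenerated (I : TwoSidedIdeal (H →L[ℂ] H)) : Prop :=
  ∃ G : Set (H →L[ℂ] H), G.Countable ∧ I = TwoSidedIdeal.span G

end OperatorIdeal

end

/-! Membership in an ideal is read off from `s`-numbers, so the theorem becomes a statement about
sequences. `preAmInfty I` lies in `I` because a summable `ξ` is eventually dominated by an
ampliation of `ξ_{a∞}` (`eventuallyDominated_seqAmInfty`), and it is am-∞ closed directly from the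
definitions (`isAmInftyClosed_preAmInfty`). Neither fact uses countable generation.

The substance is maximality. Let `J ⊆ I` be am-∞ closed and let `ξ = s(X)` with `X ∈ J`. Closedness
puts every `μ` with `μ_{a∞} ≤ 2 ξ_{a∞}` into `Σ(J) ⊆ Σ(I)`. If `ξ_{a∞} ∉ Σ(I)`, a diagonal argument
against the generators contradicts this. The operators of `I` satisfy one of countably many bounds
(`exists_sNumbers_le_of_mem_span`), and `ξ_{a∞}` violates the `k`-th at arbitrarily large indices.
Choose violating indices `n k` so sparse that the tail sums of `ξ` at least halve from one to the
next. The step sequence `μ = ∑ₖ ξ_{a∞}(n k) · 1_{[0, n k]}` has `μ_{a∞} ≤ 2 ξ_{a∞}`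
(`exists_step_sequence`), yet violates every bound.

The passage between operators and sequences is Calkin's correspondence, obtained from diagonal
operators, a greedy choice of orthonormal vectors and the singular value decomposition. `I` itself
may contain noncompact operators. -/

namespace OperatorIdeal

/-! ### Singular numbers of bounded operators -/

section SNumbers

variable {H : Type*} [NormedAddCommGroup H] [InnerProductSpace ℂ H]

instance (n : ℕ) :
    Nonempty {F : H →L[ℂ] H // LinearMap.rank (F : H →ₗ[ℂ] H) ≤ (n : Cardinal)} :=
  ⟨⟨0, by simp⟩⟩

lemma sNumbers_bddBelow (X : H →L[ℂ] H) (n : ℕ) : BddBelow (Set.range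
    fun F : {F : H →L[ℂ] H // LinearMap.rank (F : H →ₗ[ℂ] H) ≤ (n : Cardinal)} =>
      ‖X - (F : H →L[ℂ] H)‖) :=
  ⟨0, by rintro _ ⟨F, rfl⟩; exact norm_nonneg _⟩

lemma sNumbers_le {X F : H →L[ℂ] H} {n : ℕ}
    (hF : LinearMap.rank (F : H →ₗ[ℂ] H) ≤ (n : Cardinal)) : sNumbers X n ≤ ‖X - F‖ :=
  ciInf_le (sNumbers_bddBelow X n) ⟨F, hF⟩

lemma le_sNumbers {X : H →L[ℂ] H} {n : ℕ} {t : ℝ}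
    (h : ∀ F : H →L[ℂ] H, LinearMap.rank (F : H →ₗ[ℂ] H) ≤ (n : Cardinal) → t ≤ ‖X - F‖) :
    t ≤ sNumbers X n :=
  le_ciInf fun F => h F F.2

lemma exists_rank_le_norm_sub_lt (X : H →L[ℂ] H) (n : ℕ) {r : ℝ} (hr : sNumbers X n < r) :
    ∃ F : H →L[ℂ] H, LinearMap.rank (F : H →ₗ[ℂ] H) ≤ (n : Cardinal) ∧ ‖X - F‖ < r := by
  obtain ⟨F, hF⟩ := exists_lt_of_ciInf_lt hr
  exact ⟨F, F.2, hF⟩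

lemma sNumbers_nonneg (X : H →L[ℂ] H) (n : ℕ) : 0 ≤ sNumbers X n :=
  le_sNumbers fun _ _ => norm_nonneg _

lemma sNumbers_antitone (X : H →L[ℂ] H) : Antitone (sNumbers X) := fun m n hmn =>
  le_sNumbers fun _ hF => sNumbers_le (hF.trans (by exact_mod_cast hmn))

lemma sNumbers_le_norm (X : H →L[ℂ] H) (n : ℕ) : sNumbers X n ≤ ‖X‖ := by
  simpa using sNumbers_le (X := X) (F := 0) (n := n) (by simp)

@[simp] lemma sNumbers_zero : sNumbers (0 : H →L[ℂ] H) = 0 := by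
  ext n
  exact le_antisymm (by simpa using sNumbers_le_norm (0 : H →L[ℂ] H) n) (sNumbers_nonneg _ n)

lemma sNumbers_zero_index (X : H →L[ℂ] H) : sNumbers X 0 = ‖X‖ := by
  refine le_antisymm (sNumbers_le_norm X 0) (le_sNumbers fun F hF => ?_)
  have h : LinearMap.range (F : H →ₗ[ℂ] H) = ⊥ := by
    rw [← Submodule.rank_eq_zero]
    exact le_antisymm (by simpa using hF) zero_le
  have hF0 : F = 0 := by
    ext x
    have : (F : H →ₗ[ℂ] H) = 0 := LinearMap.range_eq_bot.1 h
    exact LinearMap.congr_fun this x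
  simp [hF0]

lemma sNumbers_add_le (X Y : H →L[ℂ] H) (m n : ℕ) :
    sNumbers (X + Y) (m + n) ≤ sNumbers X m + sNumbers Y n := by
  refine le_of_forall_pos_le_add fun ε hε => ?_
  obtain ⟨F, hF, hXF⟩ := exists_rank_le_norm_sub_lt X m (lt_add_of_pos_right _ (half_pos hε))
  obtain ⟨G, hG, hYG⟩ := exists_rank_le_norm_sub_lt Y n (lt_add_of_pos_right _ (half_pos hε))
  have hr : LinearMap.rank ((F + G : H →L[ℂ] H) : H →ₗ[ℂ] H) ≤ ((m + n : ℕ) : Cardinal) := by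
    push_cast
    exact (LinearMap.rank_add_le _ _).trans (add_le_add hF hG)
  have h1 := sNumbers_le (X := X + Y) hr
  have h2 : ‖X + Y - (F + G)‖ ≤ ‖X - F‖ + ‖Y - G‖ := by
    rw [add_sub_add_comm]; exact norm_add_le _ _
  linarith

lemma sNumbers_mul_le_left (A X : H →L[ℂ] H) (n : ℕ) :
    sNumbers (A * X) n ≤ ‖A‖ * sNumbers X n := by
  refine le_of_forall_pos_le_add fun ε hε => ?_
  obtain ⟨F, hF, hXF⟩ := exists_rank_le_norm_sub_lt X n
    (lt_add_of_pos_right _ (div_pos hε (by positivity : 0 < ‖A‖ + 1)))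
  have hr : LinearMap.rank ((A * F : H →L[ℂ] H) : H →ₗ[ℂ] H) ≤ (n : Cardinal) :=
    (LinearMap.rank_comp_le_right (F : H →ₗ[ℂ] H) (A : H →ₗ[ℂ] H)).trans hF
  have h1 := sNumbers_le (X := A * X) hr
  have h2 : ‖A * X - A * F‖ ≤ ‖A‖ * ‖X - F‖ := by
    rw [← mul_sub]; exact norm_mul_le _ _
  have h3 : ‖A‖ * ‖X - F‖ ≤ ‖A‖ * (sNumbers X n + ε / (‖A‖ + 1)) := by gcongr
  have h4 : ‖A‖ * (ε / (‖A‖ + 1)) ≤ ε := by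
    rw [mul_div_assoc', div_le_iff₀ (by positivity)]
    nlinarith
  linarith

lemma sNumbers_mul_le_right (X B : H →L[ℂ] H) (n : ℕ) :
    sNumbers (X * B) n ≤ ‖B‖ * sNumbers X n := by
  refine le_of_forall_pos_le_add fun ε hε => ?_
  obtain ⟨F, hF, hXF⟩ := exists_rank_le_norm_sub_lt X n
    (lt_add_of_pos_right _ (div_pos hε (by positivity : 0 < ‖B‖ + 1)))
  have hr : LinearMap.rank ((F * B : H →L[ℂ] H) : H →ₗ[ℂ] H) ≤ (n : Cardinal) :=
    (LinearMap.rank_comp_le_left (B : H →ₗ[ℂ] H) (F : H →ₗ[ℂ] H)).trans hF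
  have h1 := sNumbers_le (X := X * B) hr
  have h2 : ‖X * B - F * B‖ ≤ ‖B‖ * ‖X - F‖ := by
    rw [← sub_mul, mul_comm]; exact norm_mul_le _ _
  have h3 : ‖B‖ * ‖X - F‖ ≤ ‖B‖ * (sNumbers X n + ε / (‖B‖ + 1)) := by gcongr
  have h4 : ‖B‖ * (ε / (‖B‖ + 1)) ≤ ε := by
    rw [mul_div_assoc', div_le_iff₀ (by positivity)]
    nlinarith
  linarith

@[simp] lemma sNumbers_neg (X : H →L[ℂ] H) : sNumbers (-X) = sNumbers X := by
  have key : ∀ Y : H →L[ℂ] H, sNumbers (-Y) ≤ sNumbers Y := fun Y n => le_sNumbers fun F hF => by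
    have hr : LinearMap.rank ((-F : H →L[ℂ] H) : H →ₗ[ℂ] H) ≤ (n : Cardinal) := by
      have : ((-F : H →L[ℂ] H) : H →ₗ[ℂ] H) = (-LinearMap.id) ∘ₗ (F : H →ₗ[ℂ] H) := by
        ext; simp
      rw [this]
      exact (LinearMap.rank_comp_le_right _ _).trans hF
    have := sNumbers_le (X := -Y) hr
    rwa [neg_sub_neg, norm_sub_rev] at this
  exact le_antisymm (key X) (by simpa using key (-X))

/-- The near-optimal approximants in the definition of the `s`-numbers have finite rank and converge
to `X` in norm. -/
lemma isCompactOperator_of_tendsto_sNumbers [CompleteSpace H] {X : H →L[ℂ] H}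
    (hX : Tendsto (sNumbers X) atTop (𝓝 0)) : IsCompactOperator X := by
  have hF : ∀ n : ℕ, ∃ F : H →L[ℂ] H, LinearMap.rank (F : H →ₗ[ℂ] H) ≤ (n : Cardinal) ∧
      ‖X - F‖ < sNumbers X n + 1 / ((n : ℝ) + 1) := fun n =>
    exists_rank_le_norm_sub_lt X n (lt_add_of_pos_right _ (by positivity))
  choose F hr hXF using hF
  have ht : Tendsto F atTop (𝓝 X) := by
    rw [tendsto_iff_norm_sub_tendsto_zero]
    refine squeeze_zero (fun _ => norm_nonneg _) (fun n => ?_)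
      (by simpa only [add_zero] using hX.add tendsto_one_div_add_atTop_nhds_zero_nat)
    rw [norm_sub_rev]
    exact (hXF n).le
  refine isCompactOperator_of_tendsto ht (Eventually.of_forall fun n => ?_)
  have hfd : FiniteDimensional ℂ (LinearMap.range (F n : H →ₗ[ℂ] H)) :=
    Module.finite_of_rank_eq_nat (Cardinal.lt_aleph0.1 ((hr n).trans_lt
      Cardinal.natCast_lt_aleph0)).choose_spec
  let G : H →L[ℂ] LinearMap.range (F n : H →ₗ[ℂ] H) :=
    (F n).codRestrict _ fun x => LinearMap.mem_range_self _ x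
  have : ProperSpace (LinearMap.range (F n : H →ₗ[ℂ] H)) := FiniteDimensional.proper ℂ _
  have hG : IsCompactOperator G := isCompactOperator_of_locallyCompactSpace_dom G
  exact hG.clm_comp (Submodule.subtypeL _)

end SNumbers

/-! ### Diagonal operators between orthogonal families -/

section Diagonal

variable {H : Type*} [NormedAddCommGroup H] [InnerProductSpace ℂ H]

local notation "⟪" x ", " y "⟫" => inner ℂ x y

/-- A family of pairwise orthogonal vectors of norm at most one. -/
structure IsSubOrthonormal (u : ℕ → H) : Prop where
  norm_le : ∀ i, ‖u i‖ ≤ 1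
  inner_eq_zero : Pairwise fun i j => ⟪u i, u j⟫ = 0

lemma _root_.Orthonormal.isSubOrthonormal {u : ℕ → H} (hu : Orthonormal ℂ u) :
    IsSubOrthonormal u :=
  ⟨fun i => (hu.1 i).le, hu.2⟩

lemma IsSubOrthonormal.comp {u : ℕ → H} (hu : IsSubOrthonormal u) {φ : ℕ → ℕ}
    (hφ : φ.Injective) : IsSubOrthonormal (u ∘ φ) :=
  ⟨fun _ => hu.1 _, fun _ _ hij => hu.2 (hφ.ne hij)⟩

lemma norm_sq_sum_of_pairwise {w : ℕ → H} (s : Finset ℕ)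
    (hw : ∀ i ∈ s, ∀ j ∈ s, i ≠ j → ⟪w i, w j⟫ = 0) :
    ‖∑ i ∈ s, w i‖ ^ 2 = ∑ i ∈ s, ‖w i‖ ^ 2 := by
  classical
  induction s using Finset.induction_on with
  | empty => simp
  | insert a s ha ih =>
    rw [Finset.sum_insert ha, Finset.sum_insert ha, ← ih fun i hi j hj =>
      hw i (Finset.mem_insert_of_mem hi) j (Finset.mem_insert_of_mem hj), sq, sq, sq]
    refine norm_add_sq_eq_norm_sq_add_norm_sq_of_inner_eq_zero (𝕜 := ℂ) _ _ ?_
    rw [inner_sum]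
    refine Finset.sum_eq_zero fun i hi => hw _ (Finset.mem_insert_self _ _) _
      (Finset.mem_insert_of_mem hi) ?_
    rintro rfl; exact ha hi

lemma IsSubOrthonormal.norm_sq_sum_le {u : ℕ → H} (hu : IsSubOrthonormal u) (a : ℕ → ℂ)
    (s : Finset ℕ) : ‖∑ i ∈ s, a i • u i‖ ^ 2 ≤ ∑ i ∈ s, ‖a i‖ ^ 2 := by
  rw [norm_sq_sum_of_pairwise]
  · refine Finset.sum_le_sum fun i _ => ?_
    rw [norm_smul]
    have := hu.1 i
    gcongr
    exact mul_le_of_le_one_right (norm_nonneg _) this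
  · intro i _ j _ hij
    simp [hu.2 hij]

lemma IsSubOrthonormal.sum_inner_sq_le {v : ℕ → H} (hv : IsSubOrthonormal v) (x : H)
    (s : Finset ℕ) : ∑ i ∈ s, ‖⟪v i, x⟫‖ ^ 2 ≤ ‖x‖ ^ 2 := by
  have h1 := hv.norm_sq_sum_le (fun i => ⟪v i, x⟫) s
  have h2 : RCLike.re ⟪x, ∑ i ∈ s, ⟪v i, x⟫ • v i⟫ = ∑ i ∈ s, ‖⟪v i, x⟫‖ ^ 2 := by
    rw [inner_sum, map_sum]
    refine Finset.sum_congr rfl fun i _ => ?_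
    rw [inner_smul_right, inner_mul_symm_re_eq_norm, norm_mul, norm_inner_symm x, sq]
  have h3 := norm_sub_sq (𝕜 := ℂ) x (∑ i ∈ s, ⟪v i, x⟫ • v i)
  rw [h2] at h3
  nlinarith [sq_nonneg ‖x - ∑ i ∈ s, ⟪v i, x⟫ • v i‖]

lemma IsSubOrthonormal.summable [CompleteSpace H] {u : ℕ → H} (hu : IsSubOrthonormal u)
    {a : ℕ → ℂ} (ha : Summable fun i => ‖a i‖ ^ 2) : Summable fun i => a i • u i := by
  rw [summable_iff_vanishing_norm] at ha ⊢
  intro ε hε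
  obtain ⟨s, hs⟩ := ha (ε ^ 2) (by positivity)
  refine ⟨s, fun t ht => ?_⟩
  have h1 := hs t ht
  rw [Real.norm_eq_abs] at h1
  have h2 := (hu.norm_sq_sum_le a t).trans_lt ((le_abs_self _).trans_lt h1)
  exact lt_of_pow_lt_pow_left₀ 2 hε.le h2

/-- `T x = ∑ₙ dₙ ⟪vₙ, x⟫ uₙ` for every `x`. -/
def IsDiagonal (T : H →L[ℂ] H) (u : ℕ → H) (d : ℕ → ℝ) (v : ℕ → H) : Prop :=
  ∀ x, HasSum (fun n => ((d n : ℂ) * ⟪v n, x⟫) • u n) (T x)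

variable {u v w : ℕ → H} {d c : ℕ → ℝ} {S T : H →L[ℂ] H}

lemma IsDiagonal.unique (hS : IsDiagonal S u d v) (hT : IsDiagonal T u d v) : S = T := by
  ext x; exact (hS x).unique (hT x)

lemma IsDiagonal.add (hS : IsDiagonal S u c v) (hT : IsDiagonal T u d v) :
    IsDiagonal (S + T) u (c + d) v := fun x => by
  rw [add_apply]
  convert! (hS x).add (hT x) using 2 with n
  simp [add_mul, add_smul]

lemma IsDiagonal.apply (hT : IsDiagonal T u d v) (hv : IsSubOrthonormal v) (n : ℕ) :
    T (v n) = ((d n : ℂ) * ⟪v n, v n⟫) • u n := by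
  refine (hT (v n)).unique ?_
  convert! hasSum_single n ?_ using 1
  intro m hm
  simp [hv.2 hm]

lemma IsDiagonal.apply' (hT : IsDiagonal T u d v) (hv : Orthonormal ℂ v) (n : ℕ) :
    T (v n) = (d n : ℂ) • u n := by
  have := inner_self_eq_norm_sq_to_K (𝕜 := ℂ) (v n)
  rw [hT.apply hv.isSubOrthonormal, this, hv.1]
  simp

/-- Composing inserts the factor `⟪u n, u n⟫`, which must equal one wherever the entry `d n` does
not already vanish. -/
lemma IsDiagonal.comp (hS : IsDiagonal S w c u) (hT : IsDiagonal T u d v)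
    (hu : IsSubOrthonormal u) (hd : ∀ n, d n ≠ 0 → ‖u n‖ = 1) :
    IsDiagonal (S * T) w (c * d) v := fun x => by
  rw [mul_apply_eq_comp]
  convert! (hT x).mapL S using 2 with n
  rw [map_smul, hS.apply hu, smul_smul]
  congr 1
  by_cases h : d n = 0
  · simp [h]
  · have := inner_self_eq_norm_sq_to_K (𝕜 := ℂ) (u n)
    rw [this, hd n h]
    simp
    ring

/-- Bessel's inequality for `v` makes the coefficients square summable, and orthogonality of `u`
turns this into convergence and the norm bound. -/
lemma exists_isDiagonal [CompleteSpace H] (hu : IsSubOrthonormal u) (hv : IsSubOrthonormal v)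
    {C : ℝ} (hd : ∀ n, |d n| ≤ C) :
    ∃ T : H →L[ℂ] H, IsDiagonal T u d v ∧ ‖T‖ ≤ C := by
  have hC : 0 ≤ C := (abs_nonneg _).trans (hd 0)
  have hb : ∀ x s, ∑ n ∈ s, ‖(d n : ℂ) * ⟪v n, x⟫‖ ^ 2 ≤ (C * ‖x‖) ^ 2 := fun x s => by
    calc ∑ n ∈ s, ‖(d n : ℂ) * ⟪v n, x⟫‖ ^ 2 ≤ ∑ n ∈ s, C ^ 2 * ‖⟪v n, x⟫‖ ^ 2 := by
          refine Finset.sum_le_sum fun n _ => ?_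
          rw [norm_mul, mul_pow, Complex.norm_real, Real.norm_eq_abs]
          gcongr
          exact hd n
      _ ≤ (C * ‖x‖) ^ 2 := by
          rw [← Finset.mul_sum, mul_pow]
          gcongr
          exact hv.sum_inner_sq_le x s
  have hs : ∀ x, Summable fun n => ((d n : ℂ) * ⟪v n, x⟫) • u n := fun x =>
    hu.summable (summable_of_sum_le (fun n => sq_nonneg _) (hb x))
  let L : H →ₗ[ℂ] H :=
    { toFun := fun x => ∑' n, ((d n : ℂ) * ⟪v n, x⟫) • u n
      map_add' := fun x y => by
        rw [← (hs x).tsum_add (hs y)]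
        simp [mul_add, add_smul]
      map_smul' := fun a x => by
        rw [RingHom.id_apply, ← (hs x).tsum_const_smul]
        congr 1; ext n
        rw [inner_smul_right, smul_smul]
        congr 1; ring }
  have hL : ∀ x, ‖L x‖ ≤ C * ‖x‖ := fun x => by
    refine le_of_tendsto ((hs x).hasSum.norm) (Eventually.of_forall fun s => ?_)
    exact le_of_sq_le_sq ((hu.norm_sq_sum_le _ s).trans (hb x s)) (by positivity)
  exact ⟨L.mkContinuous C hL, fun x => (hs x).hasSum, L.mkContinuous_norm_le hC hL⟩

/-- If `X` maps an orthonormal family to a family of pairwise orthogonal vectors of norm at least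
`t`, then the corresponding `s`-number is at least `t`. -/
lemma le_sNumbers_of_orthonormal {X : H →L[ℂ] H} {e : ℕ → H} (he : Orthonormal ℂ e)
    (hXe : Pairwise fun i j => ⟪X (e i), X (e j)⟫ = 0) {n : ℕ} {t : ℝ} (ht0 : 0 ≤ t)
    (ht : ∀ i ≤ n, t ≤ ‖X (e i)‖) : t ≤ sNumbers X n := by
  refine le_sNumbers fun F hF => ?_
  let g : (Fin (n + 1) → ℂ) →ₗ[ℂ] H := Fintype.linearCombination ℂ fun i : Fin (n + 1) => e i
  -- `F` has rank at most `n`, so it kills a nonzero vector of the span of `e 0, …, e n`, on which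
  -- `X` expands norms by at least `t`.
  have hker : ¬ Function.Injective ((F : H →ₗ[ℂ] H) ∘ₗ g) := by
    intro hinj
    have h1 := LinearMap.lift_rank_le_of_injective ((F : H →ₗ[ℂ] H) ∘ₗ g).rangeRestrict
      (fun a b h => hinj (congrArg Subtype.val h))
    have h2 : Module.rank ℂ (LinearMap.range ((F : H →ₗ[ℂ] H) ∘ₗ g)) ≤ (n : Cardinal) :=
      (Submodule.rank_mono (LinearMap.range_comp_le_range _ _)).trans hF
    have h3 := h1.trans (Cardinal.lift_le.2 h2)
    simp at h3
  obtain ⟨a, ha, ha0⟩ : ∃ a, F (g a) = 0 ∧ a ≠ 0 := by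
    rw [← LinearMap.ker_eq_bot, Submodule.eq_bot_iff] at hker
    push Not at hker
    simpa using hker
  let a' : ℕ → ℂ := fun i => if h : i < n + 1 then a ⟨i, h⟩ else 0
  have hga : g a = ∑ i ∈ Finset.range (n + 1), a' i • e i := by
    rw [Finset.sum_range, show g a = ∑ i : Fin (n + 1), a i • e i from rfl]
    refine Finset.sum_congr rfl fun i _ => ?_
    simp only [a', dif_pos i.2]
  have hn1 : ‖g a‖ ^ 2 = ∑ i ∈ Finset.range (n + 1), ‖a' i‖ ^ 2 := by
    rw [hga, norm_sq_sum_of_pairwise]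
    · simp [norm_smul, he.1]
    · intro i _ j _ hij
      simp [he.2 hij]
  have hn2 : ‖X (g a)‖ ^ 2 = ∑ i ∈ Finset.range (n + 1), ‖a' i‖ ^ 2 * ‖X (e i)‖ ^ 2 := by
    rw [hga, map_sum, norm_sq_sum_of_pairwise]
    · simp [norm_smul, mul_pow]
    · intro i _ j _ hij
      simp [hXe hij]
  have hpos : 0 < ‖g a‖ := by
    obtain ⟨i, hi⟩ := Function.ne_iff.1 ha0
    have : 0 < ‖g a‖ ^ 2 := by
      rw [hn1]
      refine Finset.sum_pos' (fun _ _ => sq_nonneg _) ⟨i, Finset.mem_range.2 i.2, ?_⟩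
      have : a' i = a i := by simp only [a', dif_pos i.2]
      rw [this]
      have : 0 < ‖a i‖ := norm_pos_iff.2 hi
      positivity
    exact (norm_nonneg _).lt_of_ne fun h => by simp [← h] at this
  have h1 : (t * ‖g a‖) ^ 2 ≤ ‖X (g a)‖ ^ 2 := by
    rw [mul_pow, hn1, hn2, Finset.mul_sum]
    refine Finset.sum_le_sum fun i hi => ?_
    rw [mul_comm]
    have := ht i (by simpa [Nat.lt_succ_iff] using hi)
    gcongr
  have h2 : t * ‖g a‖ ≤ ‖X (g a)‖ := le_of_sq_le_sq h1 (norm_nonneg _)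
  have h3 : ‖X (g a)‖ ≤ ‖X - F‖ * ‖g a‖ := by
    have := (X - F).le_opNorm (g a)
    simpa [ha] using this
  exact le_of_mul_le_mul_right (h2.trans h3) hpos

lemma sNumbers_eq_of_isDiagonal [CompleteSpace H] {b : ℕ → H} (hb : Orthonormal ℂ b)
    (hd : Antitone d) (hd0 : ∀ n, 0 ≤ d n) (hT : IsDiagonal T b d b) : sNumbers T = d := by
  ext n
  have hTb := hT.apply' hb
  refine le_antisymm ?_ (le_sNumbers_of_orthonormal hb ?_ (hd0 n) ?_)
  · have hb' := hb.isSubOrthonormal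
    -- `R` is the part of `T` from index `n` on: its norm is at most `d n`, and `T - R` has rank at
    -- most `n`.
    obtain ⟨R, hR, hRn⟩ := exists_isDiagonal (d := fun i => if i < n then 0 else d i) hb' hb'
      (C := d n) fun i => by
        split_ifs with h
        · simpa using hd0 n
        · rw [abs_of_nonneg (hd0 i)]; exact hd (not_lt.1 h)
    classical
    have hF : LinearMap.rank ((T - R : H →L[ℂ] H) : H →ₗ[ℂ] H) ≤ (n : Cardinal) := by
      have hle : LinearMap.range ((T - R : H →L[ℂ] H) : H →ₗ[ℂ] H) ≤
          Submodule.span ℂ (((Finset.range n).image b : Finset H) : Set H) := by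
        rintro _ ⟨x, rfl⟩
        have h1 : HasSum (fun i => ((if i < n then d i else 0 : ℝ) * ⟪b i, x⟫) • b i)
            ((T - R) x) := by
          rw [sub_apply]
          convert! (hT x).sub (hR x) using 2 with i
          by_cases hi : i < n <;> simp [hi]
        have h2 := h1.unique (hasSum_sum_of_ne_finset_zero (s := Finset.range n) fun i hi => by
          rw [Finset.mem_range] at hi; simp [hi])
        rw [ContinuousLinearMap.coe_coe, h2]
        refine Submodule.sum_mem _ fun i hi => Submodule.smul_mem _ _ (Submodule.subset_span ?_)
        exact Finset.mem_coe.2 (Finset.mem_image_of_mem _ hi)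
      refine (Submodule.rank_mono hle).trans ((rank_span_finset_le _).trans ?_)
      exact_mod_cast Finset.card_image_le.trans (Finset.card_range n).le
    have := sNumbers_le (X := T) hF
    rw [sub_sub_cancel] at this
    exact this.trans hRn
  · intro i j hij
    simp [hTb, hb.2 hij]
  · intro i hi
    rw [hTb, norm_smul, hb.1, mul_one, Complex.norm_real, Real.norm_eq_abs]
    exact (hd hi).trans (le_abs_self _)

end Diagonal

/-! ### Greedy orthonormal sequences and the singular value decomposition -/

section Greedy

variable {H : Type*} [NormedAddCommGroup H] [InnerProductSpace ℂ H]

local notation "⟪" x ", " y "⟫" => inner ℂ x y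

/-- Used with `T = X* X`: choosing each `e n` orthogonal to all earlier `e i` and `X* X (e i)` makes
both the `e n` and the `X (e n)` pairwise orthogonal. -/
lemma exists_greedy_seq (T : H →L[ℂ] H) (Inv : Submodule ℂ H → Prop)
    (Good : Submodule ℂ H → H → Prop) (h0 : Inv ⊥)
    (step : ∀ M, Inv M → ∃ e, Good M e ∧ Inv (M ⊔ Submodule.span ℂ {e, T e})) :
    ∃ (e : ℕ → H) (M : ℕ → Submodule ℂ H), M 0 = ⊥ ∧
      (∀ n, M (n + 1) = M n ⊔ Submodule.span ℂ {e n, T (e n)}) ∧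
      ∀ n, Inv (M n) ∧ Good (M n) (e n) := by
  choose f hf hf' using step
  let M : ℕ → {M // Inv M} := fun n =>
    Nat.rec ⟨⊥, h0⟩ (fun _ N => ⟨N.1 ⊔ Submodule.span ℂ {f N.1 N.2, T (f N.1 N.2)}, hf' _ N.2⟩) n
  exact ⟨fun n => f (M n).1 (M n).2, fun n => (M n).1, rfl, fun _ => rfl,
    fun n => ⟨(M n).2, hf _ _⟩⟩

variable {T : H →L[ℂ] H} {e : ℕ → H} {M : ℕ → Submodule ℂ H}

lemma mem_greedy (hM : ∀ n, M (n + 1) = M n ⊔ Submodule.span ℂ {e n, T (e n)}) {i n : ℕ}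
    (hin : i < n) : e i ∈ M n ∧ T (e i) ∈ M n := by
  have hmono : Monotone M := monotone_nat_of_le_succ fun n => by rw [hM]; exact le_sup_left
  have hle : Submodule.span ℂ {e i, T (e i)} ≤ M n :=
    (le_sup_right.trans (hM i).ge).trans (hmono hin)
  exact ⟨hle (Submodule.subset_span (by simp)), hle (Submodule.subset_span (by simp))⟩

lemma orthonormal_greedy (hM : ∀ n, M (n + 1) = M n ⊔ Submodule.span ℂ {e n, T (e n)})
    (he : ∀ n, e n ∈ (M n)ᗮ) (he1 : ∀ n, ‖e n‖ = 1) : Orthonormal ℂ e := by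
  refine ⟨he1, fun i j hij => ?_⟩
  rcases lt_or_gt_of_ne hij with h | h
  · exact (Submodule.mem_orthogonal _ _).1 (he j) _ (mem_greedy hM h).1
  · exact (Submodule.mem_orthogonal' _ _).1 (he i) _ (mem_greedy hM h).1

lemma pairwise_inner_greedy [CompleteSpace H] {X : H →L[ℂ] H} {e : ℕ → H}
    (hM : ∀ n, M (n + 1) = M n ⊔ Submodule.span ℂ {e n, (X.adjoint * X) (e n)})
    (he : ∀ n, e n ∈ (M n)ᗮ) : Pairwise fun i j => ⟪X (e i), X (e j)⟫ = 0 := by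
  have key : ∀ i j, i < j → ⟪X (e i), X (e j)⟫ = 0 := fun i j h => by
    rw [← ContinuousLinearMap.adjoint_inner_left]
    exact (Submodule.mem_orthogonal _ _).1 (he j) _ (mem_greedy hM h).2
  intro i j hij
  rcases lt_or_gt_of_ne hij with h | h
  · exact key i j h
  · exact inner_eq_zero_symm.1 (key j i h)

lemma rank_greedy_le (hM0 : M 0 = ⊥)
    (hM : ∀ n, M (n + 1) = M n ⊔ Submodule.span ℂ {e n, T (e n)}) (n : ℕ) :
    Module.rank ℂ (M n) ≤ ((2 * n : ℕ) : Cardinal) := by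
  classical
  induction n with
  | zero => rw [hM0]; simp
  | succ n ih =>
    rw [hM, mul_add, Nat.cast_add]
    refine (Submodule.rank_add_le_rank_add_rank _ _).trans (add_le_add ih ?_)
    have h := rank_span_finset_le (R := ℂ) ({e n, T (e n)} : Finset H)
    rw [Finset.coe_pair] at h
    refine h.trans ?_
    exact_mod_cast Finset.card_le_two

lemma orthogonal_ne_bot (hH : ¬ FiniteDimensional ℂ H) (N : Submodule ℂ H)
    [FiniteDimensional ℂ N] : Nᗮ ≠ ⊥ := fun h => by
  rw [Submodule.orthogonal_eq_bot_iff] at h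
  subst h
  exact hH (Module.Finite.equiv (Submodule.topEquiv (R := ℂ) (M := H)))

/-- Unit vectors normalise nonzero ones. -/
lemma exists_norm_eq_one_of_ne_zero {N : Submodule ℂ H} {x : H} (hx : x ∈ N) (hx0 : x ≠ 0) :
    ∃ e ∈ N, ‖e‖ = 1 ∧ x = (‖x‖ : ℂ) • e := by
  have h : (‖x‖ : ℂ) ≠ 0 := by simpa using hx0
  refine ⟨(‖x‖ : ℂ)⁻¹ • x, N.smul_mem _ hx, ?_, ?_⟩
  · rw [norm_smul, norm_inv, Complex.norm_real, norm_norm, inv_mul_cancel₀ (by simpa using hx0)]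
  · rw [smul_smul, mul_inv_cancel₀ h, one_smul]

/-- Strictness is required only when the restricted norm is positive, so that the zero restriction,
where any unit vector serves, is covered too. -/
lemma exists_almost_norming (X : H →L[ℂ] H) {N : Submodule ℂ H} (hN : N ≠ ⊥) {a : ℝ}
    (ha0 : 0 < ‖X ∘L N.subtypeL‖ → a < ‖X ∘L N.subtypeL‖)
    (ha1 : a ≤ ‖X ∘L N.subtypeL‖) : ∃ e ∈ N, ‖e‖ = 1 ∧ a ≤ ‖X e‖ := by
  rcases (norm_nonneg (X ∘L N.subtypeL)).eq_or_lt with h | h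
  · obtain ⟨x, hx, hx0⟩ := (Submodule.ne_bot_iff _).1 hN
    obtain ⟨e, he, he1, -⟩ := exists_norm_eq_one_of_ne_zero hx hx0
    exact ⟨e, he, he1, (ha1.trans h.ge).trans (norm_nonneg _)⟩
  · obtain ⟨x, hx1, hx⟩ := ContinuousLinearMap.exists_lt_apply_of_lt_opNorm _
      (max_lt (ha0 h) h)
    have hx' : max a 0 < ‖X (x : H)‖ := hx
    have hx0 : (x : H) ≠ 0 := fun h0 => by
      rw [h0, map_zero, norm_zero] at hx'
      exact (le_max_right a 0).not_gt hx'
    obtain ⟨e, he, he1, hxe⟩ := exists_norm_eq_one_of_ne_zero x.2 hx0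
    refine ⟨e, he, he1, ((le_max_left a 0).trans hx'.le).trans ?_⟩
    rw [hxe, map_smul, norm_smul, Complex.norm_real, norm_norm]
    exact mul_le_of_le_one_left (norm_nonneg _) (by simpa using hx1.le)

lemma norm_apply_le_of_mem (X : H →L[ℂ] H) {N : Submodule ℂ H} {y : H} (hy : y ∈ N) :
    ‖X y‖ ≤ ‖X ∘L N.subtypeL‖ * ‖y‖ := (X ∘L N.subtypeL).le_opNorm ⟨y, hy⟩

lemma exists_half_norming (X : H →L[ℂ] H) {N : Submodule ℂ H} (hN : N ≠ ⊥) :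
    ∃ e ∈ N, ‖e‖ = 1 ∧ ∀ y ∈ N, ‖X y‖ ≤ 2 * ‖X e‖ * ‖y‖ := by
  obtain ⟨e, he, he1, h⟩ := exists_almost_norming X hN
    (a := ‖X ∘L N.subtypeL‖ / 2) (fun h => by linarith) (by linarith [norm_nonneg (X ∘L N.subtypeL)])
  refine ⟨e, he, he1, fun y hy => (norm_apply_le_of_mem X hy).trans ?_⟩
  gcongr
  linarith

/-- A compact operator attains its norm on a closed subspace invariant under `X* X`, at an
eigenvector of `X* X`. -/
lemma exists_norming_eigenvector [CompleteSpace H] {X : H →L[ℂ] H} (hX : IsCompactOperator X)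
    {N : Submodule ℂ H} (hNc : IsClosed (N : Set H)) (hN : N ≠ ⊥)
    (hinv : ∀ x ∈ N, (X.adjoint * X) x ∈ N) :
    ∃ e ∈ N, ‖e‖ = 1 ∧ (∀ y ∈ N, ‖X y‖ ≤ ‖X e‖ * ‖y‖) ∧
      ∃ c : ℂ, (X.adjoint * X) e = c • e := by
  set σ := ‖X ∘L N.subtypeL‖ with hσ
  set T := X.adjoint * X with hT
  have hσ0 : 0 ≤ σ := norm_nonneg (X ∘L N.subtypeL)
  have hTx : ∀ x, T x = X.adjoint (X x) := fun _ => rfl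
  rcases hσ0.eq_or_lt with h0 | hpos
  · obtain ⟨x, hx, hx0⟩ := (Submodule.ne_bot_iff _).1 hN
    obtain ⟨e, he, he1, -⟩ := exists_norm_eq_one_of_ne_zero hx hx0
    have hz : ∀ y ∈ N, X y = 0 := fun y hy => by
      have := norm_apply_le_of_mem X hy
      rw [← hσ, ← h0, zero_mul] at this
      exact norm_le_zero_iff.1 this
    exact ⟨e, he, he1, fun y hy => by simp [hz y hy, hz e he], 0, by simp [hTx, hz e he]⟩
  have hseq : ∀ n : ℕ, ∃ e ∈ N, ‖e‖ = 1 ∧ σ - 1 / ((n : ℝ) + 1) ≤ ‖X e‖ := fun n => by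
    have : (0 : ℝ) < 1 / ((n : ℝ) + 1) := by positivity
    exact exists_almost_norming X hN (fun _ => by linarith) (by linarith)
  choose x hxN hx1 hxσ using hseq
  have hXx : ∀ n, ‖X (x n)‖ ≤ σ := fun n => by
    simpa [hx1] using norm_apply_le_of_mem X (hxN n)
  have hlim : Tendsto (fun n => ‖X (x n)‖) atTop (𝓝 σ) := by
    refine tendsto_of_tendsto_of_tendsto_of_le_of_le ?_ tendsto_const_nhds hxσ hXx
    simpa only [sub_zero] using
      (tendsto_const_nhds (x := σ)).sub (tendsto_one_div_add_atTop_nhds_zero_nat (𝕜 := ℝ))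
  -- Invariance of `N` is what allows the bound `σ` on `X` restricted to `N` to be applied to `T (x
  -- n)`.
  have hTn : ∀ n, ‖T (x n)‖ ≤ σ ^ 2 := fun n => by
    have h1 : ‖T (x n)‖ ^ 2 = RCLike.re ⟪X (x n), X (T (x n))⟫ := by
      rw [← inner_self_eq_norm_sq (𝕜 := ℂ)]
      nth_rewrite 1 [hTx]
      rw [ContinuousLinearMap.adjoint_inner_left]
    have h2 : ‖T (x n)‖ ^ 2 ≤ σ * (σ * ‖T (x n)‖) := by
      rw [h1]
      refine (re_inner_le_norm _ _).trans ?_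
      have := norm_apply_le_of_mem X (hinv _ (hxN n))
      have := hXx n
      gcongr
    by_contra! hlt
    nlinarith [sq_nonneg σ]
  -- A maximising sequence consists of approximate eigenvectors: expand the square and use `⟪T x, x⟫
  -- = ‖X x‖²`.
  have hdiff : Tendsto (fun n => T (x n) - ((σ ^ 2 : ℝ) : ℂ) • x n) atTop (𝓝 0) := by
    rw [tendsto_zero_iff_norm_tendsto_zero]
    have hb : ∀ n, ‖T (x n) - ((σ ^ 2 : ℝ) : ℂ) • x n‖ ^ 2 ≤
        2 * σ ^ 2 * (σ ^ 2 - ‖X (x n)‖ ^ 2) := fun n => by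
      rw [norm_sub_sq (𝕜 := ℂ), inner_smul_right, hTx, ContinuousLinearMap.adjoint_inner_left,
        ← hTx, inner_self_eq_norm_sq_to_K, norm_smul, hx1, Complex.norm_real, Real.norm_eq_abs,
        abs_of_nonneg (sq_nonneg σ)]
      have h1 : RCLike.re (((σ ^ 2 : ℝ) : ℂ) * ((‖X (x n)‖ : ℂ) ^ 2)) =
          σ ^ 2 * ‖X (x n)‖ ^ 2 := by
        rw [← Complex.ofReal_pow, ← Complex.ofReal_mul]; rfl
      have h2 : ‖T (x n)‖ ^ 2 ≤ (σ ^ 2) ^ 2 := by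
        have := hTn n
        gcongr
      erw [h1]
      nlinarith
    have hb' : Tendsto (fun n => √(2 * σ ^ 2 * (σ ^ 2 - ‖X (x n)‖ ^ 2))) atTop (𝓝 0) := by
      have : Tendsto (fun n => √(2 * σ ^ 2 * (σ ^ 2 - ‖X (x n)‖ ^ 2))) atTop
          (𝓝 √(2 * σ ^ 2 * (σ ^ 2 - σ ^ 2))) :=
        (((hlim.pow 2).const_sub _).const_mul _).sqrt
      simpa using this
    exact squeeze_zero (fun _ => norm_nonneg _) (fun n => Real.le_sqrt_of_sq_le (hb n)) hb'
  have hTc : IsCompactOperator T := hX.clm_comp X.adjoint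
  -- Compactness makes `T (x n)` converge along a subsequence; since `σ ≠ 0`, so does `x n`.
  obtain ⟨z, -, φ, hφ, hz⟩ := (hTc.isCompact_closure_image_closedBall 1).tendsto_subseq
    (x := fun n => T (x n)) fun n => subset_closure ⟨x n, by simp [hx1], rfl⟩
  have hσc : ((σ ^ 2 : ℝ) : ℂ) ≠ 0 := by exact_mod_cast (pow_pos hpos 2).ne'
  have hxlim : Tendsto (x ∘ φ) atTop (𝓝 (((σ ^ 2 : ℝ) : ℂ)⁻¹ • z)) := by
    have h := (hz.sub (hdiff.comp hφ.tendsto_atTop)).const_smul (((σ ^ 2 : ℝ) : ℂ)⁻¹)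
    rw [sub_zero] at h
    refine h.congr fun n => ?_
    simp only [Function.comp_apply, sub_sub_cancel]
    rw [smul_smul, inv_mul_cancel₀ hσc, one_smul]
  set e := ((σ ^ 2 : ℝ) : ℂ)⁻¹ • z with he
  have hXe : ‖X e‖ = σ :=
    tendsto_nhds_unique ((X.continuous.tendsto e).comp hxlim).norm (hlim.comp hφ.tendsto_atTop)
  refine ⟨e, hNc.mem_of_tendsto hxlim (Eventually.of_forall fun n => hxN _), ?_, ?_,
    ((σ ^ 2 : ℝ) : ℂ), ?_⟩
  · refine tendsto_nhds_unique hxlim.norm ?_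
    simp [hx1]
  · intro y hy
    rw [hXe]
    exact norm_apply_le_of_mem X hy
  · have h1 : Tendsto (fun n => T (x (φ n)) - ((σ ^ 2 : ℝ) : ℂ) • x (φ n)) atTop
        (𝓝 (T e - ((σ ^ 2 : ℝ) : ℂ) • e)) :=
      ((T.continuous.tendsto e).comp hxlim).sub (hxlim.const_smul _)
    exact sub_eq_zero.1 (tendsto_nhds_unique h1 (hdiff.comp hφ.tendsto_atTop))

/-- Normalisation of a family of pairwise orthogonal vectors, with zero vectors left unchanged. -/
lemma exists_normalize {g : ℕ → H} (hg : Pairwise fun i j => ⟪g i, g j⟫ = 0) :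
    ∃ f : ℕ → H, IsSubOrthonormal f ∧ (∀ n, ‖g n‖ ≠ 0 → ‖f n‖ = 1) ∧
      ∀ n, g n = (‖g n‖ : ℂ) • f n := by
  have h1 : ∀ n, ‖g n‖ ≠ 0 → ‖(‖g n‖ : ℂ)⁻¹ • g n‖ = 1 := fun n h => by
    rw [norm_smul, norm_inv, Complex.norm_real, norm_norm, inv_mul_cancel₀ h]
  refine ⟨fun n => (‖g n‖ : ℂ)⁻¹ • g n, ⟨fun n => ?_, fun i j hij => ?_⟩, h1, fun n => ?_⟩
  · by_cases h : ‖g n‖ = 0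
    · simp [h]
    · exact (h1 n h).le
  · simp [hg hij]
  · by_cases h : ‖g n‖ = 0
    · simp [norm_eq_zero.1 h]
    · rw [smul_smul, mul_inv_cancel₀ (by exact_mod_cast h), one_smul]

/-- Every operator acts diagonally between two orthogonal families, with entries comparable from
below with its `s`-numbers. -/
lemma exists_diagonal_minorant [CompleteSpace H] (hH : ¬ FiniteDimensional ℂ H) (X : H →L[ℂ] H) :
    ∃ (e f : ℕ → H) (t : ℕ → ℝ), Orthonormal ℂ e ∧ IsSubOrthonormal f ∧
      (∀ n, t n ≠ 0 → ‖f n‖ = 1) ∧ (∀ n, X (e n) = (t n : ℂ) • f n) ∧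
      (∀ n, 0 ≤ t n ∧ t n ≤ ‖X‖) ∧ ∀ n, sNumbers X (2 * n) ≤ 2 * t n := by
  obtain ⟨e, M, hM0, hM, hgood⟩ := exists_greedy_seq (X.adjoint * X)
    (fun M => FiniteDimensional ℂ M)
    (fun M e => e ∈ Mᗮ ∧ ‖e‖ = 1 ∧ ∀ y ∈ Mᗮ, ‖X y‖ ≤ 2 * ‖X e‖ * ‖y‖)
    (inferInstanceAs (FiniteDimensional ℂ (⊥ : Submodule ℂ H))) fun M hM => by
      obtain ⟨e, he⟩ := exists_half_norming X (orthogonal_ne_bot hH M)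
      have := FiniteDimensional.span_of_finite ℂ (Set.toFinite {e, (X.adjoint * X) e})
      exact ⟨e, he, Submodule.finiteDimensional_sup _ _⟩
  have he := orthonormal_greedy hM (fun n => (hgood n).2.1) (fun n => (hgood n).2.2.1)
  obtain ⟨f, hf, hf1, hXf⟩ := exists_normalize (g := fun n => X (e n))
    (pairwise_inner_greedy hM fun n => (hgood n).2.1)
  refine ⟨e, f, fun n => ‖X (e n)‖, he, hf, hf1, hXf, fun n => ⟨norm_nonneg _, ?_⟩, fun n => ?_⟩
  · simpa [he.1] using X.le_opNorm (e n)
  · have := (hgood n).1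
    -- `X` composed with the projection onto `M n` competes for the `s`-number of index `2 * n`,
    -- since each greedy step adds at most two dimensions; the remainder is controlled by
    -- half-norming.
    have hr : LinearMap.rank ((X * (M n).starProjection : H →L[ℂ] H) : H →ₗ[ℂ] H) ≤
        ((2 * n : ℕ) : Cardinal) := by
      refine (LinearMap.rank_comp_le_right ((M n).starProjection : H →ₗ[ℂ] H)
        (X : H →ₗ[ℂ] H)).trans (le_trans ?_ (rank_greedy_le hM0 hM n))
      refine Submodule.rank_mono ?_
      rintro _ ⟨x, rfl⟩
      exact (M n).starProjection_apply_mem x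
    refine (sNumbers_le (X := X) hr).trans
      (ContinuousLinearMap.opNorm_le_bound _ (by positivity) fun x => ?_)
    have h1 : (X - X * (M n).starProjection) x = X (x - (M n).starProjection x) := by
      simp [map_sub]
    rw [h1]
    refine ((hgood n).2.2.2 _ ((M n).sub_starProjection_mem_orthogonal x)).trans ?_
    gcongr
    have h2 := (M n).norm_sq_eq_add_norm_sq_starProjection x
    rw [Submodule.starProjection_orthogonal_val] at h2
    nlinarith [norm_nonneg x, norm_nonneg (x - (M n).starProjection x), sq_nonneg ‖(M n).starProjection x‖]

/-- The singular value decomposition of a compact operator. -/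
lemma exists_singular_value_decomposition [CompleteSpace H] (hH : ¬ FiniteDimensional ℂ H)
    {X : H →L[ℂ] H} (hX : Tendsto (sNumbers X) atTop (𝓝 0)) :
    ∃ (e f : ℕ → H) (t : ℕ → ℝ), Orthonormal ℂ e ∧ IsSubOrthonormal f ∧
      (∀ n, 0 ≤ t n ∧ t n ≤ sNumbers X n) ∧ IsDiagonal X f t e := by
  have hXc := isCompactOperator_of_tendsto_sNumbers hX
  obtain ⟨e, M, hM0, hM, hgood⟩ := exists_greedy_seq (X.adjoint * X)
    (fun M => FiniteDimensional ℂ M ∧ ∀ x ∈ M, (X.adjoint * X) x ∈ M)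
    (fun M e => e ∈ Mᗮ ∧ ‖e‖ = 1 ∧ (∀ y ∈ Mᗮ, ‖X y‖ ≤ ‖X e‖ * ‖y‖) ∧
      ∃ c : ℂ, (X.adjoint * X) e = c • e)
    ⟨inferInstanceAs (FiniteDimensional ℂ (⊥ : Submodule ℂ H)), by simp⟩ fun M hM => by
      have := hM.1
      obtain ⟨e, he⟩ := exists_norming_eigenvector hXc (Submodule.isClosed_orthogonal M)
        (orthogonal_ne_bot hH M) fun x hx => by
          rw [Submodule.mem_orthogonal] at hx ⊢
          intro u hu
          rw [mul_apply_eq_comp, ContinuousLinearMap.adjoint_inner_right,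
            ← ContinuousLinearMap.adjoint_inner_left]
          exact hx _ (hM.2 u hu)
      obtain ⟨c, hc⟩ := he.2.2.2
      have := FiniteDimensional.span_of_finite ℂ (Set.toFinite {e, (X.adjoint * X) e})
      refine ⟨e, he, Submodule.finiteDimensional_sup _ _, fun x hx => ?_⟩
      obtain ⟨y, hy, z, hz, rfl⟩ := Submodule.mem_sup.1 hx
      rw [map_add]
      refine Submodule.add_mem_sup (hM.2 y hy) ?_
      obtain ⟨a, b, rfl⟩ := Submodule.mem_span_pair.1 hz
      rw [hc, map_add, map_smul, map_smul, map_smul, hc]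
      exact Submodule.mem_span_pair.2 ⟨a * c, b * c, by simp [smul_smul, mul_assoc]⟩
  have heM : ∀ n, e n ∈ (M n)ᗮ := fun n => (hgood n).2.1
  have he := orthonormal_greedy hM heM (fun n => (hgood n).2.2.1)
  have hXe := pairwise_inner_greedy hM heM
  -- The `e n` being eigenvectors of `X* X`, the second vector of each step adds nothing new.
  have hspan : ∀ n, M n ≤ Submodule.span ℂ (e '' Set.Iio n) := fun n => by
    induction n with
    | zero => rw [hM0]; exact bot_le
    | succ n ih =>
      rw [hM]
      have hen : e n ∈ Submodule.span ℂ (e '' Set.Iio (n + 1)) :=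
        Submodule.subset_span ⟨n, by simp, rfl⟩
      refine sup_le (ih.trans (Submodule.span_mono (Set.image_mono
        (Set.Iio_subset_Iio n.le_succ)))) (Submodule.span_le.2 ?_)
      rintro x (rfl | rfl)
      · exact hen
      · obtain ⟨c, hc⟩ := (hgood n).2.2.2.2
        rw [hc]
        exact Submodule.smul_mem _ _ hen
  obtain ⟨f, hf, hf1, hXf⟩ := exists_normalize hXe
  have hts : ∀ n, ‖X (e n)‖ ≤ sNumbers X n := fun n =>
    le_sNumbers_of_orthonormal he hXe (norm_nonneg _) fun i hi => by
      have hmem : e n ∈ (M i)ᗮ := by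
        refine Submodule.orthogonal_le ?_ (heM n)
        exact monotone_nat_of_le_succ (f := M) (fun n => by rw [hM]; exact le_sup_left) hi
      simpa [he.1] using (hgood i).2.2.2.1 _ hmem
  refine ⟨e, f, fun n => ‖X (e n)‖, he, hf, fun n => ⟨norm_nonneg _, hts n⟩, ?_⟩
  obtain ⟨R, hR, -⟩ := exists_isDiagonal (d := fun n => ‖X (e n)‖) hf he.isSubOrthonormal
    (C := ‖X‖) fun n => by simpa [he.1] using X.le_opNorm (e n)
  suffices R = X by rwa [this] at hR
  ext x
  refine tendsto_nhds_unique (hR x).tendsto_sum_nat ?_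
  -- Partial sums of `R x` are `X` applied to partial Fourier sums of `x`; the error is at most
  -- `sNumbers X n * ‖x‖`, so completeness of `e` is not needed.
  have hsum : ∀ n, ∑ i ∈ Finset.range n, ((‖X (e i)‖ : ℂ) * ⟪e i, x⟫) • f i =
      X x - X (x - ∑ i ∈ Finset.range n, ⟪e i, x⟫ • e i) := fun n => by
    rw [map_sub, sub_sub_cancel, map_sum]
    refine Finset.sum_congr rfl fun i _ => ?_
    rw [map_smul, mul_comm, mul_smul, ← hXf]
  simp only [hsum]
  suffices h : Tendsto (fun n => X (x - ∑ i ∈ Finset.range n, ⟪e i, x⟫ • e i)) atTop (𝓝 0) by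
    simpa using h.const_sub (X x)
  have hlim : Tendsto (fun n => sNumbers X n * ‖x‖) atTop (𝓝 0) := by
    simpa using hX.mul_const ‖x‖
  refine squeeze_zero_norm (fun n => ?_) hlim
  set y := x - ∑ i ∈ Finset.range n, ⟪e i, x⟫ • e i with hy
  have hort : ∀ i < n, ⟪e i, y⟫ = 0 := fun i hi => by
    rw [hy, inner_sub_right, he.inner_right_sum _ (Finset.mem_range.2 hi), sub_self]
  have hyM : y ∈ (M n)ᗮ := by
    refine Submodule.orthogonal_le (hspan n) ((Submodule.mem_orthogonal _ _).2 fun u hu => ?_)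
    induction hu using Submodule.span_induction with
    | mem u hu => obtain ⟨i, hi, rfl⟩ := hu; exact hort i hi
    | zero => simp
    | add u v _ _ hu hv => simp [inner_add_left, hu, hv]
    | smul a u _ hu => simp [inner_smul_left, hu]
  have hyx : ‖y‖ ≤ ‖x‖ := by
    have h0 : ⟪y, ∑ i ∈ Finset.range n, ⟪e i, x⟫ • e i⟫ = 0 := by
      rw [inner_sum]
      refine Finset.sum_eq_zero fun i hi => ?_
      rw [inner_smul_right, inner_eq_zero_symm.1 (hort i (Finset.mem_range.1 hi)), mul_zero]
    have h1 := norm_add_sq_eq_norm_sq_add_norm_sq_of_inner_eq_zero (𝕜 := ℂ) _ _ h0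
    rw [hy, sub_add_cancel, ← hy] at h1
    nlinarith [norm_nonneg x, norm_nonneg y,
      mul_self_nonneg ‖∑ i ∈ Finset.range n, ⟪e i, x⟫ • e i‖]
  calc ‖X y‖ ≤ ‖X (e n)‖ * ‖y‖ := (hgood n).2.2.2.1 _ hyM
    _ ≤ sNumbers X n * ‖x‖ := by
        have := hts n
        gcongr
        exact sNumbers_nonneg _ _

end Greedy

/-! ### Domination of sequences and characteristic sets -/

/-- `ξ` is dominated, up to a constant factor, by an ampliation of `η`. -/
def Dominated (ξ η : ℕ → ℝ) : Prop :=
  ∃ m : ℕ, 0 < m ∧ ∃ C : ℝ, 0 ≤ C ∧ ∀ k, ξ (m * k) ≤ C * η k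

/-- `ξ` is eventually dominated, up to a constant factor, by an ampliation of `η`. -/
def EventuallyDominated (ξ η : ℕ → ℝ) : Prop :=
  ∃ m : ℕ, 0 < m ∧ ∃ C : ℝ, 0 ≤ C ∧ ∀ᶠ k in atTop, ξ (m * k) ≤ C * η k

lemma nonneg_of_mem_c0Star {ξ : ℕ → ℝ} (hξ : ξ ∈ c0Star) (n : ℕ) : 0 ≤ ξ n :=
  hξ.1.le_of_tendsto hξ.2 n

lemma Dominated.mem_c0Star {ξ η : ℕ → ℝ} (h : Dominated ξ η) (hξ : Antitone ξ)
    (hξ0 : ∀ n, 0 ≤ ξ n) (hη : Tendsto η atTop (𝓝 0)) : ξ ∈ c0Star := by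
  obtain ⟨m, hm, C, hC, hk⟩ := h
  refine ⟨hξ, ?_⟩
  have h1 : Tendsto (fun n => C * η (n / m)) atTop (𝓝 0) := by
    simpa using (hη.comp (Nat.tendsto_div_const_atTop hm.ne')).const_mul C
  exact squeeze_zero hξ0 (fun n => (hξ (Nat.mul_div_le n m)).trans (hk _)) h1

/-- A larger ampliation pushes every `k ≥ 1` past the exceptional range; `k = 0` is absorbed into
the constant, which needs `η 0 > 0`. -/
lemma EventuallyDominated.dominated {ξ η : ℕ → ℝ} (h : EventuallyDominated ξ η)
    (hη : Antitone η) (hη0 : ∀ n, 0 ≤ η n) (hpos : 0 < η 0) : Dominated ξ η := by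
  obtain ⟨m, hm, C, hC, hk⟩ := h
  obtain ⟨N, hN⟩ := eventually_atTop.1 hk
  refine ⟨m * (N + 1), by positivity, max C (ξ 0 / η 0), hC.trans (le_max_left _ _), fun k => ?_⟩
  rcases k.eq_zero_or_pos with rfl | hk
  · rw [mul_zero, ← div_le_iff₀ hpos]
    exact le_max_right _ _
  · rw [mul_assoc]
    refine (hN _ (by nlinarith)).trans ?_
    have h1 : η ((N + 1) * k) ≤ η k := hη (by nlinarith)
    have := hη0 ((N + 1) * k)
    have := hη0 k
    gcongr
    exact le_max_left _ _

/-- The closure properties of the characteristic set of an ideal. -/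
structure IsCharSet (S : Set (ℕ → ℝ)) : Prop where
  subset : S ⊆ c0Star
  zero_mem : 0 ∈ S
  add_mem : ∀ {ξ η}, ξ ∈ S → η ∈ S → ξ + η ∈ S
  of_dominated : ∀ {ξ η}, ξ ∈ c0Star → η ∈ S → Dominated ξ η → ξ ∈ S

/-! ### Calkin's correspondence -/

section Ideals

variable {H : Type*} [NormedAddCommGroup H] [InnerProductSpace ℂ H]

/-- The operators with `s`-numbers in `S` already form an ideal, so taking the span adds nothing. -/
lemma mem_idealOfCharSet_iff {S : Set (ℕ → ℝ)} (hS : IsCharSet S) {X : H →L[ℂ] H} :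
    X ∈ idealOfCharSet S ↔ sNumbers X ∈ S := by
  have hdom : ∀ {Y : H →L[ℂ] H} {η : ℕ → ℝ}, η ∈ S → Dominated (sNumbers Y) η →
      sNumbers Y ∈ S := fun {Y η} hη h =>
    hS.of_dominated (h.mem_c0Star (sNumbers_antitone Y) (sNumbers_nonneg Y) (hS.subset hη).2) hη h
  let K : TwoSidedIdeal (H →L[ℂ] H) := TwoSidedIdeal.mk' {X | sNumbers X ∈ S}
    (by simpa using hS.zero_mem)
    (fun {X Y} hX hY => hdom (hS.add_mem hX hY) ⟨2, two_pos, 1, zero_le_one, fun k => by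
      rw [two_mul, one_mul]; exact sNumbers_add_le X Y k k⟩)
    (fun {X} hX => by simpa using hX)
    (fun {A X} hX => hdom hX ⟨1, one_pos, ‖A‖, norm_nonneg _, fun k => by
      rw [one_mul]; exact sNumbers_mul_le_left A X k⟩)
    (fun {X B} hX => hdom hX ⟨1, one_pos, ‖B‖, norm_nonneg _, fun k => by
      rw [one_mul]; exact sNumbers_mul_le_right X B k⟩)
  refine ⟨fun h => ?_, fun h => TwoSidedIdeal.subset_span h⟩
  have hle : idealOfCharSet S ≤ K := TwoSidedIdeal.span_le.2 fun Y hY => by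
    simpa [K, TwoSidedIdeal.mem_mk'] using hY
  simpa [K, TwoSidedIdeal.mem_mk'] using hle h

/-- The operators satisfying such a bound form an ideal containing each `G i`. A single integer
governs the ampliation, the constant and the number of generators, which prepares the diagonal
argument. -/
lemma exists_sNumbers_le_of_mem_span {G : ℕ → H →L[ℂ] H} {X : H →L[ℂ] H}
    (hX : X ∈ TwoSidedIdeal.span (Set.range G)) :
    ∃ k : ℕ, ∀ j, sNumbers X ((k + 1) * j) ≤
      ((k : ℝ) + 1) * ∑ i ∈ Finset.range (k + 1), sNumbers (G i) j := by
  have hmono : ∀ {k l : ℕ} (j : ℕ), k ≤ l → ∑ i ∈ Finset.range (k + 1), sNumbers (G i) j ≤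
      ∑ i ∈ Finset.range (l + 1), sNumbers (G i) j := fun j h =>
    Finset.sum_le_sum_of_subset_of_nonneg (Finset.range_mono (by omega))
      fun i _ _ => sNumbers_nonneg _ _
  have hnn : ∀ k j : ℕ, 0 ≤ ∑ i ∈ Finset.range (k + 1), sNumbers (G i) j := fun k j =>
    Finset.sum_nonneg fun i _ => sNumbers_nonneg _ _
  have hscale : ∀ {X Y : H →L[ℂ] H} {r : ℝ}, 0 ≤ r → (∀ n, sNumbers Y n ≤ r * sNumbers X n) →
      (∃ k : ℕ, ∀ j, sNumbers X ((k + 1) * j) ≤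
        ((k : ℝ) + 1) * ∑ i ∈ Finset.range (k + 1), sNumbers (G i) j) →
      ∃ k : ℕ, ∀ j, sNumbers Y ((k + 1) * j) ≤
        ((k : ℝ) + 1) * ∑ i ∈ Finset.range (k + 1), sNumbers (G i) j := by
    rintro X Y r hr hXY ⟨k, hk⟩
    obtain ⟨l, hl⟩ := exists_nat_ge (r * ((k : ℝ) + 1))
    refine ⟨k + l, fun j => ?_⟩
    calc sNumbers Y ((k + l + 1) * j) ≤ sNumbers Y ((k + 1) * j) :=
          sNumbers_antitone Y (by gcongr; omega)
      _ ≤ r * (((k : ℝ) + 1) * ∑ i ∈ Finset.range (k + 1), sNumbers (G i) j) :=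
          (hXY _).trans (by have := hk j; gcongr)
      _ ≤ ((k + l : ℕ) + 1) * ∑ i ∈ Finset.range (k + l + 1), sNumbers (G i) j := by
          rw [← mul_assoc]
          have h1 := hmono j (Nat.le_add_right k l)
          have h2 := hnn k j
          gcongr
          push_cast
          linarith [(Nat.cast_nonneg k : (0 : ℝ) ≤ k)]
  let K : TwoSidedIdeal (H →L[ℂ] H) := TwoSidedIdeal.mk' {X | ∃ k : ℕ, ∀ j,
      sNumbers X ((k + 1) * j) ≤
        ((k : ℝ) + 1) * ∑ i ∈ Finset.range (k + 1), sNumbers (G i) j}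
    ⟨0, fun j => by simpa using sNumbers_nonneg _ _⟩
    (by
      rintro X Y ⟨k, hk⟩ ⟨l, hl⟩
      refine ⟨k + l + 1, fun j => ?_⟩
      have h1 := sNumbers_add_le X Y ((k + 1) * j) ((l + 1) * j)
      have h2 := hmono j (show k ≤ k + l + 1 by omega)
      have h3 := hmono j (show l ≤ k + l + 1 by omega)
      rw [show (k + l + 1 + 1) * j = (k + 1) * j + (l + 1) * j by ring]
      push_cast
      nlinarith [hk j, hl j, (Nat.cast_nonneg k : (0 : ℝ) ≤ k), (Nat.cast_nonneg l : (0 : ℝ) ≤ l)])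
    (fun {X} hX => by simpa using hX)
    (fun {A X} hX => hscale (norm_nonneg A) (sNumbers_mul_le_left A X) hX)
    (fun {X B} hX => hscale (norm_nonneg B) (sNumbers_mul_le_right X B) hX)
  have hle : TwoSidedIdeal.span (Set.range G) ≤ K := TwoSidedIdeal.span_le.2 fun Y hY => by
    obtain ⟨i, rfl⟩ := hY
    have hmem : ∃ k : ℕ, ∀ j, sNumbers (G i) ((k + 1) * j) ≤
        ((k : ℝ) + 1) * ∑ i ∈ Finset.range (k + 1), sNumbers (G i) j := by
      refine ⟨i, fun j => ?_⟩
      have h1 : sNumbers (G i) ((i + 1) * j) ≤ sNumbers (G i) j :=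
        sNumbers_antitone _ (by nlinarith)
      have h2 : sNumbers (G i) j ≤ ∑ i ∈ Finset.range (i + 1), sNumbers (G i) j :=
        Finset.single_le_sum (f := fun i => sNumbers (G i) j) (fun i _ => sNumbers_nonneg _ _)
          (Finset.self_mem_range_succ i)
      nlinarith [hnn i j, (Nat.cast_nonneg i : (0 : ℝ) ≤ i)]
    simpa [K, TwoSidedIdeal.mem_mk'] using hmem
  simpa [K, TwoSidedIdeal.mem_mk'] using hle hX

local notation "⟪" x ", " y "⟫" => inner ℂ x y

lemma isDiagonal_finset_sum {ι : Type*} {s : Finset ι} {u v : ℕ → H} {d : ι → ℕ → ℝ}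
    {D : ι → H →L[ℂ] H} (hD : ∀ i ∈ s, IsDiagonal (D i) u (d i) v) :
    IsDiagonal (∑ i ∈ s, D i) u (∑ i ∈ s, d i) v := fun x => by
  convert! hasSum_sum fun i hi => hD i hi x using 1
  · ext n
    simp [Finset.sum_mul, Finset.sum_smul]
  · simp

variable [CompleteSpace H]

variable {I : TwoSidedIdeal (H →L[ℂ] H)} {b : ℕ → H} {d : ℕ → ℝ} {D X : H →L[ℂ] H}

lemma exists_orthonormal_seq (hH : ¬ FiniteDimensional ℂ H) : ∃ b : ℕ → H, Orthonormal ℂ b := by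
  obtain ⟨e, f, t, he, -⟩ := exists_diagonal_minorant hH (0 : H →L[ℂ] H)
  exact ⟨e, he⟩

/-- `D` factors as `A * (X * B)`: `B` carries `b` to `e`, `X` carries `e` to `f` with weights `t`,
and `A` returns to `b` with weights `d / t`. Where `t n = 0`, the hypothesis forces `d n = 0`, in
agreement with division by zero. -/
lemma isDiagonal_mem_of_le (hH : ¬ FiniteDimensional ℂ H) (hb : Orthonormal ℂ b) (hX : X ∈ I)
    {C : ℝ} (hd : ∀ n, |d n| ≤ C * sNumbers X (2 * n)) (hD : IsDiagonal D b d b) : D ∈ I := by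
  obtain ⟨e, f, t, he, hf, hf1, hXe, ht, hs⟩ := exists_diagonal_minorant hH X
  have hdt : ∀ n, |d n| ≤ 2 * |C| * t n := fun n => by
    have h1 := hs n
    calc |d n| ≤ |C| * sNumbers X (2 * n) := (hd n).trans (by
          have := sNumbers_nonneg X (2 * n)
          gcongr
          exact le_abs_self C)
      _ ≤ |C| * (2 * t n) := by gcongr
      _ = 2 * |C| * t n := by ring
  obtain ⟨A, hA, -⟩ := exists_isDiagonal (d := fun n => d n / t n) hb.isSubOrthonormal hf
    (C := 2 * |C|) fun n => by
      rw [abs_div, abs_of_nonneg (ht n).1]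
      exact div_le_of_le_mul₀ (ht n).1 (by positivity) (hdt n)
  obtain ⟨B, hB, -⟩ := exists_isDiagonal (d := fun _ => 1) he.isSubOrthonormal
    hb.isSubOrthonormal (C := 1) fun n => by simp
  have hXB : IsDiagonal (X * B) f t b := fun x => by
    rw [mul_apply_eq_comp]
    convert! (hB x).mapL X using 2 with n
    rw [map_smul, hXe, smul_smul]
    congr 1
    simp [mul_comm]
  have hAXB := hA.comp hXB hf hf1
  have hdd : (fun n => d n / t n) * t = d := by
    ext n
    by_cases h : t n = 0
    · have := hdt n
      rw [h, mul_zero] at this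
      simp [h, abs_nonpos_iff.1 this]
    · simp [h]
  rw [hdd] at hAXB
  rw [hD.unique hAXB]
  exact I.mul_mem_left _ _ (I.mul_mem_right _ _ hX)

/-- Split `D` by residues of the index modulo `2 * m`. On the class `n = 2 * m * k + r` one has `n /
m ≥ 2 * k`, so `isDiagonal_mem_of_le` applies to the compressed sequence. -/
lemma isDiagonal_mem_of_le_div (hH : ¬ FiniteDimensional ℂ H) (hb : Orthonormal ℂ b) (hX : X ∈ I)
    {m : ℕ} (hm : 0 < m) {C : ℝ} (hC : 0 ≤ C) (hd : ∀ n, |d n| ≤ C * sNumbers X (n / m))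
    (hD : IsDiagonal D b d b) : D ∈ I := by
  have hb' := hb.isSubOrthonormal
  have hbound : ∀ n, |d n| ≤ C * ‖X‖ := fun n => (hd n).trans <| by
    have := sNumbers_le_norm X (n / m)
    gcongr
  have hr : ∀ r < 2 * m, ∃ R ∈ I, IsDiagonal R b (fun n => if n % (2 * m) = r then d n else 0) b := by
    intro r hr
    let φ : ℕ → ℕ := fun k => 2 * m * k + r
    have hφ : φ.Injective := fun k l h => by
      have h' : 2 * m * k = 2 * m * l := by simpa [φ] using h
      exact Nat.eq_of_mul_eq_mul_left (by positivity) h'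
    obtain ⟨E, hE, -⟩ := exists_isDiagonal (d := d ∘ φ) hb' hb' fun n => hbound (φ n)
    obtain ⟨A, hA, -⟩ := exists_isDiagonal (d := fun _ => 1) (hb'.comp hφ) hb' (C := 1)
      fun n => by simp
    obtain ⟨B, hB, -⟩ := exists_isDiagonal (d := fun _ => 1) hb' (hb'.comp hφ) (C := 1)
      fun n => by simp
    have hEI : E ∈ I := isDiagonal_mem_of_le hH hb hX (C := C) (fun n => by
      have h1 : φ n / m = 2 * n + r / m := by
        rw [show φ n = r + m * (2 * n) by simp only [φ]; ring, Nat.add_mul_div_left _ _ hm]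
        ring
      refine (hd (φ n)).trans ?_
      rw [h1]
      have := sNumbers_antitone X (Nat.le_add_right (2 * n) (r / m))
      gcongr) hE
    refine ⟨A * (E * B), I.mul_mem_left _ _ (I.mul_mem_right _ _ hEI), fun x => ?_⟩
    have h1 := hA.comp (hE.comp hB hb' fun n _ => hb.1 n) hb' (fun n _ => hb.1 n) x
    rw [← hφ.hasSum_iff]
    · convert! h1 using 2 with k
      have : φ k % (2 * m) = r := by
        simp only [φ]
        rw [Nat.mul_add_mod, Nat.mod_eq_of_lt hr]
      simp [this]
    · intro n hn
      have : n % (2 * m) ≠ r := fun h => hn ⟨n / (2 * m), by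
        simp only [φ]; rw [← h]; exact Nat.div_add_mod n (2 * m)⟩
      simp [this]
  choose! R hR hR' using hr
  have hsum := isDiagonal_finset_sum (s := Finset.range (2 * m)) (D := R)
    (d := fun r n => if n % (2 * m) = r then d n else 0) (u := b) (v := b)
    fun r hr => hR' r (Finset.mem_range.1 hr)
  have hdd : ∑ r ∈ Finset.range (2 * m), (fun n => if n % (2 * m) = r then d n else 0) = d := by
    ext n
    simp [Finset.sum_apply, Nat.mod_lt n (show 0 < 2 * m by positivity)]
  rw [hdd] at hsum
  rw [hD.unique hsum]
  exact sum_mem fun r hr => hR r (Finset.mem_range.1 hr)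

/-- A null sequence dominated by the `s`-numbers of a (not necessarily compact) operator of `I`
belongs to the characteristic set of `I`. -/
lemma mem_charSet_of_dominated (hH : ¬ FiniteDimensional ℂ H) (hX : X ∈ I) {ξ : ℕ → ℝ}
    (hξ : ξ ∈ c0Star) (h : Dominated ξ (sNumbers X)) : ξ ∈ charSet I := by
  obtain ⟨b, hb⟩ := exists_orthonormal_seq hH
  obtain ⟨m, hm, C, hC, hk⟩ := h
  have hξ0 := nonneg_of_mem_c0Star hξ
  obtain ⟨D, hD, -⟩ := exists_isDiagonal (d := ξ) hb.isSubOrthonormal hb.isSubOrthonormal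
    (C := ξ 0) fun n => by rw [abs_of_nonneg (hξ0 n)]; exact hξ.1 n.zero_le
  refine ⟨hξ, D, isDiagonal_mem_of_le_div hH hb hX hm hC (fun n => ?_) hD,
    sNumbers_eq_of_isDiagonal hb hξ.1 hξ0 hD⟩
  rw [abs_of_nonneg (hξ0 n)]
  exact (hξ.1 (Nat.mul_div_le n m)).trans (hk _)

/-- If `X = 0` then `ξ` vanishes along multiples of `m` from some point on, and any nonzero element
of `I` can replace `X`; hence `I ≠ ⊥`. -/
lemma mem_charSet_of_eventuallyDominated (hH : ¬ FiniteDimensional ℂ H) (hI : I ≠ ⊥) (hX : X ∈ I)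
    {ξ : ℕ → ℝ} (hξ : ξ ∈ c0Star) (h : EventuallyDominated ξ (sNumbers X)) : ξ ∈ charSet I := by
  have key : ∀ Y ∈ I, Y ≠ 0 → EventuallyDominated ξ (sNumbers Y) → ξ ∈ charSet I := by
    intro Y hY hY0 h
    refine mem_charSet_of_dominated hH hY hξ
      (h.dominated (sNumbers_antitone Y) (sNumbers_nonneg Y) ?_)
    rw [sNumbers_zero_index]
    exact norm_pos_iff.2 hY0
  by_cases hX0 : X = 0
  · obtain ⟨Y, hY, hY0⟩ : ∃ Y ∈ I, Y ≠ 0 := by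
      by_contra! hcon
      refine hI (TwoSidedIdeal.ext fun Y => ⟨fun hY => ?_, fun hY => ?_⟩)
      · rw [hcon Y hY]; exact TwoSidedIdeal.zero_mem _
      · rw [TwoSidedIdeal.mem_bot] at hY
        rw [hY]; exact TwoSidedIdeal.zero_mem _
    refine key Y hY hY0 ?_
    obtain ⟨m, hm, C, hC, hk⟩ := h
    refine ⟨m, hm, C, hC, hk.mono fun k hk => hk.trans ?_⟩
    rw [hX0, sNumbers_zero, Pi.zero_apply, mul_zero]
    exact mul_nonneg hC (sNumbers_nonneg Y k)
  · exact key X hX hX0 h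

/-- The singular value decomposition writes `X` as `A * (D * B)` with `D` diagonal and its entries
at most the `s`-numbers of some `Y ∈ I`. -/
lemma mem_of_sNumbers_mem_charSet (hH : ¬ FiniteDimensional ℂ H) (h : sNumbers X ∈ charSet I) :
    X ∈ I := by
  obtain ⟨hc, Y, hY, hYX⟩ := h
  obtain ⟨b, hb⟩ := exists_orthonormal_seq hH
  obtain ⟨e, f, t, he, hf, ht, hX⟩ := exists_singular_value_decomposition hH hc.2
  have hb' := hb.isSubOrthonormal
  obtain ⟨D, hD, -⟩ := exists_isDiagonal (d := t) hb' hb' (C := ‖X‖) fun n => by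
    rw [abs_of_nonneg (ht n).1]
    exact (ht n).2.trans (sNumbers_le_norm X n)
  obtain ⟨A, hA, -⟩ := exists_isDiagonal (d := fun _ => 1) hf hb' (C := 1) fun n => by simp
  obtain ⟨B, hB, -⟩ := exists_isDiagonal (d := fun _ => 1) hb' he.isSubOrthonormal (C := 1)
    fun n => by simp
  have hDI : D ∈ I := isDiagonal_mem_of_le_div hH hb hY one_pos zero_le_one (fun n => by
    rw [abs_of_nonneg (ht n).1, hYX, one_mul, Nat.div_one]
    exact (ht n).2) hD
  have h1 := hA.comp (hD.comp hB hb' fun n _ => hb.1 n) hb' fun n _ => hb.1 n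
  have h2 : (fun _ => 1) * (t * fun _ => 1) = t := by ext n; simp
  rw [h2] at h1
  rw [hX.unique h1]
  exact I.mul_mem_left _ _ (I.mul_mem_right _ _ hDI)

/-- The set of `s`-number sequences of an ideal is closed under finite sums. -/
lemma exists_mem_sNumbers_eq_sum (hH : ¬ FiniteDimensional ℂ H) {ι : Type*} (s : Finset ι)
    {G : ι → H →L[ℂ] H} (hG : ∀ i ∈ s, G i ∈ I) :
    ∃ X ∈ I, sNumbers X = ∑ i ∈ s, sNumbers (G i) := by
  obtain ⟨b, hb⟩ := exists_orthonormal_seq hH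
  have hb' := hb.isSubOrthonormal
  have hD : ∀ i, ∃ D : H →L[ℂ] H, IsDiagonal D b (sNumbers (G i)) b := fun i => by
    obtain ⟨D, hD, -⟩ := exists_isDiagonal (d := sNumbers (G i)) hb' hb' (C := ‖G i‖) fun n => by
      rw [abs_of_nonneg (sNumbers_nonneg _ _)]
      exact sNumbers_le_norm _ n
    exact ⟨D, hD⟩
  choose D hD using hD
  refine ⟨∑ i ∈ s, D i, sum_mem fun i hi => ?_, sNumbers_eq_of_isDiagonal hb ?_ ?_
    (isDiagonal_finset_sum fun i _ => hD i)⟩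
  · exact isDiagonal_mem_of_le_div hH hb (hG i hi) one_pos zero_le_one
      (fun n => by rw [abs_of_nonneg (sNumbers_nonneg _ _), one_mul, Nat.div_one]) (hD i)
  · intro m n hmn
    simp only [Finset.sum_apply]
    exact Finset.sum_le_sum fun i _ => sNumbers_antitone _ hmn
  · intro n
    simp only [Finset.sum_apply]
    exact Finset.sum_nonneg fun i _ => sNumbers_nonneg _ _

lemma isCharSet_charSet (hH : ¬ FiniteDimensional ℂ H) (I : TwoSidedIdeal (H →L[ℂ] H)) :
    IsCharSet (charSet I) where
  subset _ h := h.1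
  zero_mem := ⟨⟨antitone_const, tendsto_const_nhds⟩, 0, I.zero_mem, sNumbers_zero⟩
  add_mem := by
    rintro ξ η ⟨hξ, X, hX, rfl⟩ ⟨hη, Y, hY, rfl⟩
    refine ⟨⟨hξ.1.add hη.1, ?_⟩, ?_⟩
    · rw [← add_zero (0 : ℝ)]
      exact hξ.2.add hη.2
    obtain ⟨Z, hZ, hZs⟩ := exists_mem_sNumbers_eq_sum (I := I) hH Finset.univ
      (G := fun i : Bool => cond i X Y) (by rintro (_ | _) - <;> assumption)
    exact ⟨Z, hZ, by simpa using hZs⟩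
  of_dominated := by
    rintro ξ η hξ ⟨hη, X, hX, rfl⟩ h
    exact mem_charSet_of_dominated hH hX hξ h

lemma charSet_idealOfCharSet (hH : ¬ FiniteDimensional ℂ H) {S : Set (ℕ → ℝ)} (hS : IsCharSet S) :
    charSet (idealOfCharSet S : TwoSidedIdeal (H →L[ℂ] H)) = S := by
  ext ξ
  constructor
  · rintro ⟨-, X, hX, rfl⟩
    exact (mem_idealOfCharSet_iff hS).1 hX
  · intro hξ
    have hc := hS.subset hξ
    have hξ0 := nonneg_of_mem_c0Star hc
    obtain ⟨b, hb⟩ := exists_orthonormal_seq hH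
    obtain ⟨D, hD, -⟩ := exists_isDiagonal (d := ξ) hb.isSubOrthonormal hb.isSubOrthonormal
      (C := ξ 0) fun n => by rw [abs_of_nonneg (hξ0 n)]; exact hc.1 n.zero_le
    have hs := sNumbers_eq_of_isDiagonal hb hc.1 hξ0 hD
    exact ⟨hc, D, (mem_idealOfCharSet_iff hS).2 (hs ▸ hξ), hs⟩

end Ideals

/-! ### Arithmetic means at infinity of summable sequences -/

section Sequences

variable {ξ η : ℕ → ℝ}

lemma l1Star_subset_c0Star : l1Star ⊆ c0Star := fun _ h => ⟨h.1, h.2.2.tendsto_atTop_zero⟩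

lemma summable_shift (hξ : ξ ∈ l1Star) (n : ℕ) : Summable fun j => ξ (j + n) :=
  (summable_nat_add_iff n).2 hξ.2.2

lemma tail_antitone (hξ : ξ ∈ l1Star) : Antitone fun n => ∑' j, ξ (j + n) :=
  antitone_nat_of_succ_le fun n =>
    (summable_shift hξ (n + 1)).tsum_le_tsum (fun j => hξ.1 (by omega)) (summable_shift hξ n)

lemma tail_nonneg (hξ : ξ ∈ l1Star) (n : ℕ) : 0 ≤ ∑' j, ξ (j + n) :=
  tsum_nonneg fun _ => hξ.2.1 _

lemma tail_tendsto_zero (ξ : ℕ → ℝ) : Tendsto (fun n => ∑' j, ξ (j + n)) atTop (𝓝 0) :=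
  tendsto_sum_nat_add ξ

lemma seqAmInfty_nonneg (hξ : ξ ∈ l1Star) (n : ℕ) : 0 ≤ seqAmInfty ξ n :=
  div_nonneg (tail_nonneg hξ _) (by positivity)

lemma seqAmInfty_mul (ξ : ℕ → ℝ) (n : ℕ) :
    seqAmInfty ξ n * ((n : ℝ) + 1) = ∑' j, ξ (j + (n + 1)) :=
  div_mul_cancel₀ _ (by positivity)

lemma seqAmInfty_le_tail (hξ : ξ ∈ l1Star) (n : ℕ) : seqAmInfty ξ n ≤ ∑' j, ξ (j + (n + 1)) :=
  div_le_self (tail_nonneg hξ _) (by linarith [(Nat.cast_nonneg n : (0 : ℝ) ≤ n)])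

lemma seqAmInfty_mem_c0Star (hξ : ξ ∈ l1Star) : seqAmInfty ξ ∈ c0Star := by
  refine ⟨fun m n hmn => ?_, squeeze_zero (seqAmInfty_nonneg hξ) (seqAmInfty_le_tail hξ)
    ((tail_tendsto_zero ξ).comp (tendsto_add_atTop_nat 1))⟩
  have h1 := tail_antitone hξ (Nat.succ_le_succ hmn)
  have h2 := tail_nonneg hξ (m + 1)
  unfold seqAmInfty
  dsimp only at h1
  gcongr

lemma seqAmInfty_zero : seqAmInfty 0 = 0 := by
  ext n; simp [seqAmInfty]

lemma seqAmInfty_add (hξ : ξ ∈ l1Star) (hη : η ∈ l1Star) :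
    seqAmInfty (ξ + η) = seqAmInfty ξ + seqAmInfty η := by
  ext n
  simp only [seqAmInfty, Pi.add_apply]
  rw [(summable_shift hξ _).tsum_add (summable_shift hη _), add_div]

lemma zero_mem_l1Star : (0 : ℕ → ℝ) ∈ l1Star :=
  ⟨antitone_const, fun _ => le_rfl, summable_zero⟩

lemma add_mem_l1Star (hξ : ξ ∈ l1Star) (hη : η ∈ l1Star) : ξ + η ∈ l1Star :=
  ⟨hξ.1.add hη.1, fun n => add_nonneg (hξ.2.1 n) (hη.2.1 n), hξ.2.2.add hη.2.2⟩

lemma sum_range_mul_eq (f : ℕ → ℝ) (m N : ℕ) :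
    ∑ j ∈ Finset.range (m * N), f j =
      ∑ i ∈ Finset.range N, ∑ j ∈ Finset.range m, f (m * i + j) := by
  induction N with
  | zero => simp
  | succ N ih => rw [mul_add, mul_one, Finset.sum_range_add, ih, Finset.sum_range_succ]

/-- Group `ξ` into blocks of length `m`; by monotonicity the block starting at `m * (i + k)` sums to
at most `m * C * η (i + k)`. -/
lemma sum_range_le_of_dominated (hξ : Antitone ξ) (hη : η ∈ l1Star) {m : ℕ} {C : ℝ}
    (hC : 0 ≤ C) (h : ∀ᶠ k in atTop, ξ (m * k) ≤ C * η k) :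
    ∀ᶠ k in atTop, ∀ N, ∑ j ∈ Finset.range (m * N), ξ (j + m * k) ≤
      m * C * ∑' i, η (i + k) := by
  obtain ⟨K, hK⟩ := eventually_atTop.1 h
  refine eventually_atTop.2 ⟨K, fun k hk N => ?_⟩
  rw [sum_range_mul_eq]
  calc ∑ i ∈ Finset.range N, ∑ j ∈ Finset.range m, ξ (m * i + j + m * k)
      ≤ ∑ i ∈ Finset.range N, ∑ _j ∈ Finset.range m, C * η (i + k) := by
        gcongr with i _ j _
        refine (hξ ?_).trans (hK (i + k) (by omega))
        rw [mul_add]; omega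
    _ = m * C * ∑ i ∈ Finset.range N, η (i + k) := by
        simp [Finset.mul_sum, mul_assoc]
    _ ≤ m * C * ∑' i, η (i + k) := by
        have := (summable_shift hη k).sum_le_tsum (Finset.range N) fun _ _ => hη.2.1 _
        gcongr

lemma EventuallyDominated.mem_l1Star (h : EventuallyDominated ξ η) (hξ : Antitone ξ)
    (hξ0 : ∀ n, 0 ≤ ξ n) (hη : η ∈ l1Star) : ξ ∈ l1Star := by
  obtain ⟨m, hm, C, hC, hk⟩ := h
  obtain ⟨k, hk⟩ := (sum_range_le_of_dominated hξ hη hC hk).exists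
  refine ⟨hξ, hξ0, (summable_nat_add_iff (m * k)).1
    (summable_of_sum_range_le (fun _ => hξ0 _) fun n => le_trans ?_ (hk n))⟩
  exact Finset.sum_le_sum_of_subset_of_nonneg (Finset.range_mono (Nat.le_mul_of_pos_left n hm))
    fun _ _ _ => hξ0 _

lemma EventuallyDominated.seqAmInfty (h : EventuallyDominated ξ η) (hξ : ξ ∈ l1Star)
    (hη : η ∈ l1Star) : EventuallyDominated (seqAmInfty ξ) (seqAmInfty η) := by
  obtain ⟨m, hm, C, hC, hk⟩ := h
  -- Doubling `m` ensures `m * (k + 1) ≤ 2 * m * k + 1` for `k ≥ 1`, so the required tail of `ξ`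
  -- lies inside the one already bounded.
  refine ⟨2 * m, by positivity, m * C * 2, by positivity, ?_⟩
  filter_upwards [(tendsto_add_atTop_nat 1).eventually
    (sum_range_le_of_dominated hξ.1 hη hC hk), eventually_ge_atTop 1] with k hk hk1
  have h1 : ∑' j, ξ (j + m * (k + 1)) ≤ m * C * ∑' i, η (i + (k + 1)) :=
    Real.tsum_le_of_sum_range_le (fun _ => hξ.2.1 _) fun n =>
      (Finset.sum_le_sum_of_subset_of_nonneg
        (Finset.range_mono (Nat.le_mul_of_pos_left n hm)) fun _ _ _ => hξ.2.1 _).trans (hk n)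
  have h2 : ∑' j, ξ (j + (2 * m * k + 1)) ≤ ∑' j, ξ (j + m * (k + 1)) :=
    tail_antitone hξ (by nlinarith)
  have h3 := h2.trans h1
  rw [← seqAmInfty_mul, ← seqAmInfty_mul] at h3
  have h4 := seqAmInfty_nonneg hξ (2 * m * k)
  have h5 := seqAmInfty_nonneg hη k
  have hk1' : (1 : ℝ) ≤ k := by exact_mod_cast hk1
  have hm1 : (1 : ℝ) ≤ m := by exact_mod_cast hm
  have h6 : (k : ℝ) + 1 ≤ ((2 * m * k : ℕ) : ℝ) + 1 := by push_cast; nlinarith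
  have h7 : OperatorIdeal.seqAmInfty ξ (2 * m * k) * ((k : ℝ) + 1) ≤
      (m * C * OperatorIdeal.seqAmInfty η k) * ((k : ℝ) + 1) := by
    calc _ ≤ _ := mul_le_mul_of_nonneg_left h6 h4
      _ ≤ _ := h3
      _ = _ := by ring
  have h8 := le_of_mul_le_mul_right h7 (by positivity)
  have h9 : 0 ≤ (m : ℝ) * C * OperatorIdeal.seqAmInfty η k := by positivity
  linarith

lemma Dominated.eventuallyDominated (h : Dominated ξ η) : EventuallyDominated ξ η := by
  obtain ⟨m, hm, C, hC, hk⟩ := h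
  exact ⟨m, hm, C, hC, Eventually.of_forall hk⟩

/-- The `k + 1` terms with indices `k + 1, …, 2 * k + 1` are all at least `ξ (3 * k)` once `k ≥ 1`.
-/
lemma eventuallyDominated_seqAmInfty (hξ : ξ ∈ l1Star) :
    EventuallyDominated ξ (seqAmInfty ξ) := by
  refine ⟨3, by norm_num, 1, zero_le_one, ?_⟩
  filter_upwards [eventually_ge_atTop 1] with k hk
  have h1 : ∑ _j ∈ Finset.range (k + 1), ξ (3 * k) ≤ ∑' j, ξ (j + (k + 1)) :=
    (Finset.sum_le_sum fun j hj => hξ.1 (by rw [Finset.mem_range] at hj; omega)).trans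
      ((summable_shift hξ (k + 1)).sum_le_tsum _ fun _ _ => hξ.2.1 _)
  rw [← seqAmInfty_mul, Finset.sum_const, Finset.card_range, nsmul_eq_mul, mul_comm] at h1
  push_cast at h1
  rw [one_mul]
  exact le_of_mul_le_mul_right h1 (by positivity)

/-- Ampliation by a factor of `m`. -/
def ampliation (m : ℕ) (η : ℕ → ℝ) : ℕ → ℝ := fun n => η (n / m)

lemma dominated_ampliation {m : ℕ} (hm : 0 < m) (η : ℕ → ℝ) : Dominated (ampliation m η) η :=
  ⟨m, hm, 1, zero_le_one, fun k => by
    rw [one_mul, ampliation, Nat.mul_div_cancel_left k hm]⟩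

lemma ampliation_antitone (m : ℕ) (hη : Antitone η) : Antitone (ampliation m η) := fun _ _ h =>
  hη (Nat.div_le_div_right h)

lemma ampliation_mem_l1Star {m : ℕ} (hm : 0 < m) (hη : η ∈ l1Star) : ampliation m η ∈ l1Star :=
  (dominated_ampliation hm η).eventuallyDominated.mem_l1Star (ampliation_antitone m hη.1)
    (fun _ => hη.2.1 _) hη

/-- With `k = n / m`, the tail of the ampliation from `m * (k + 1)` is at least `m` times the tail
of `η` from `k + 1`, and `n + 1 ≤ m * (k + 1)`. This gives invariance of `Σ(J_{a∞})` under
ampliations. -/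
lemma seqAmInfty_div_le {m : ℕ} (hm : 0 < m) (hη : η ∈ l1Star) (n : ℕ) :
    seqAmInfty η (n / m) ≤ seqAmInfty (ampliation m η) n := by
  have hD := ampliation_mem_l1Star hm hη
  set k := n / m with hk
  have hn : n + 1 ≤ m * (k + 1) := Nat.lt_mul_div_succ n hm
  have h1 : m * ∑' i, η (i + (k + 1)) ≤ ∑' j, ampliation m η (j + m * (k + 1)) := by
    rw [← tsum_mul_left]
    refine Real.tsum_le_of_sum_range_le (fun _ => mul_nonneg m.cast_nonneg (hη.2.1 _)) fun N => ?_
    refine le_trans (le_of_eq ?_)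
      ((summable_shift hD (m * (k + 1))).sum_le_tsum (Finset.range (m * N)) fun _ _ => hD.2.1 _)
    rw [sum_range_mul_eq]
    refine Finset.sum_congr rfl fun i _ => ?_
    rw [Finset.sum_congr rfl fun j hj => show ampliation m η (m * i + j + m * (k + 1)) =
      η (i + (k + 1)) from ?_]
    · simp
    · rw [ampliation, show m * i + j + m * (k + 1) = j + m * (i + (k + 1)) by ring,
        Nat.add_mul_div_left _ _ hm, Nat.div_eq_of_lt (Finset.mem_range.1 hj), zero_add]
  have h2 := h1.trans (tail_antitone hD hn)
  dsimp only at h2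
  rw [← seqAmInfty_mul, ← seqAmInfty_mul] at h2
  have h3 := seqAmInfty_nonneg hη k
  have hn' : (n : ℝ) + 1 ≤ m * ((k : ℝ) + 1) := by exact_mod_cast hn
  refine le_of_mul_le_mul_right (a := (n : ℝ) + 1) ?_ (by positivity)
  calc _ ≤ seqAmInfty η k * (m * ((k : ℝ) + 1)) := by gcongr
    _ ≤ _ := by linarith

/-- A step sequence with small tail sums touching the arithmetic mean at infinity of `ξ` along a
sparse sequence of indices. -/
lemma exists_step_sequence (hξ : ξ ∈ l1Star) {n : ℕ → ℕ}
    (hn : StrictMono n)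
    (htail : ∀ k, ∑' j, ξ (j + (n (k + 1) + 1)) ≤ (∑' j, ξ (j + (n k + 1))) / 2) :
    ∃ μ ∈ l1Star, (∀ i, seqAmInfty μ i ≤ 2 * seqAmInfty ξ i) ∧
      ∀ k, seqAmInfty ξ (n k) ≤ μ (n k) := by
  set T : ℕ → ℝ := fun i => ∑' j, ξ (j + (i + 1)) with hT
  have hTanti : Antitone T := fun i j h => tail_antitone hξ (by omega : i + 1 ≤ j + 1)
  have hT0 : ∀ i, 0 ≤ T i := fun i => tail_nonneg hξ _
  have hhalf : ∀ k, T (n (k + 1)) ≤ T (n k) / 2 := htail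
  have ha0 := seqAmInfty_nonneg hξ
  have haT : ∀ k, seqAmInfty ξ (n k) ≤ T (n k) := fun k => seqAmInfty_le_tail hξ _
  have hβ : ∀ i K, ∑ k ∈ Finset.range K, (if i < n k then T (n k) else 0) ≤ 2 * T i := by
    intro i K
    -- The subtracted term makes the induction telescope: by halving, `T (n K)` is at most `2 * (T
    -- (n K) - T (n (K + 1)))`.
    suffices h : ∑ k ∈ Finset.range K, (if i < n k then T (n k) else 0) ≤
        2 * (T i - min (T (n K)) (T i)) by
      have : 0 ≤ min (T (n K)) (T i) := le_min (hT0 _) (hT0 _)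
      linarith
    induction K with
    | zero => simp
    | succ K ih =>
      rw [Finset.sum_range_succ]
      have h1 : T (n (K + 1)) ≤ T (n K) := hTanti (hn.monotone K.le_succ)
      split_ifs with h
      · have h2 : T (n K) ≤ T i := hTanti h.le
        rw [min_eq_left h2] at ih
        rw [min_eq_left (h1.trans h2)]
        linarith [hhalf K]
      · have h2 : min (T (n (K + 1))) (T i) ≤ min (T (n K)) (T i) := min_le_min_right _ h1
        linarith
  have hsumT : Summable fun k => T (n k) := by
    refine (summable_nat_add_iff 1).1 (summable_of_sum_range_le (c := 2 * T (n 0))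
      (fun k => hT0 _) fun K => ?_)
    refine le_trans ?_ (hβ (n 0) (K + 1))
    rw [Finset.sum_range_succ']
    simp [hn (Nat.succ_pos _)]
  have hsuma : Summable fun k => seqAmInfty ξ (n k) := hsumT.of_nonneg_of_le (fun k => ha0 _) haT
  have hsum : ∀ j, Summable fun k => if j ≤ n k then seqAmInfty ξ (n k) else 0 := fun j =>
    hsuma.of_nonneg_of_le (fun k => by split_ifs; exacts [ha0 _, le_rfl])
      fun k => by split_ifs; exacts [le_rfl, ha0 _]
  set μ : ℕ → ℝ := fun j => ∑' k, if j ≤ n k then seqAmInfty ξ (n k) else 0 with hμ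
  have hμ0 : ∀ j, 0 ≤ μ j := fun j => tsum_nonneg fun k => by split_ifs; exacts [ha0 _, le_rfl]
  have hμanti : Antitone μ := fun i j hij => (hsum j).tsum_le_tsum (fun k => by
    split_ifs with h1 h2 h2
    · exact le_rfl
    · exact absurd (hij.trans h1) h2
    · exact ha0 _
    · exact le_rfl) (hsum i)
  have hpart : ∀ i N, ∑ j ∈ Finset.range N, μ (j + (i + 1)) ≤ 2 * T i := by
    intro i N
    rw [← Summable.tsum_finsetSum fun j _ => hsum _]
    -- The `k`-th step has `n k + 1` entries equal to `seqAmInfty ξ (n k)`, hence total mass exactly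
    -- `T (n k)`; it reaches beyond `i` only if `i < n k`.
    have hle : ∀ k, ∑ j ∈ Finset.range N, (if j + (i + 1) ≤ n k then seqAmInfty ξ (n k) else 0) ≤
        if i < n k then T (n k) else 0 := by
      intro k
      rw [← Finset.sum_filter, Finset.sum_const, nsmul_eq_mul]
      split_ifs with h
      · rw [show T (n k) = seqAmInfty ξ (n k) * ((n k : ℝ) + 1) from (seqAmInfty_mul ξ (n k)).symm,
          mul_comm]
        have hcard : ((Finset.range N).filter fun j => j + (i + 1) ≤ n k).card ≤ n k + 1 := by
          calc _ ≤ (Finset.range (n k + 1)).card := Finset.card_le_card fun j hj => by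
                simp only [Finset.mem_filter, Finset.mem_range] at hj ⊢
                omega
            _ = n k + 1 := Finset.card_range _
        have := ha0 (n k)
        gcongr
        exact_mod_cast hcard
      · rw [Finset.filter_false_of_mem fun j _ => by omega]
        simp
    refine Real.tsum_le_of_sum_range_le (fun k => Finset.sum_nonneg fun j _ => by
      split_ifs; exacts [ha0 _, le_rfl]) fun K => ?_
    exact (Finset.sum_le_sum fun k _ => hle k).trans (hβ i K)
  have hμl1 : μ ∈ l1Star := ⟨hμanti, hμ0,
    (summable_nat_add_iff 1).1 (summable_of_sum_range_le (fun _ => hμ0 _) (hpart 0))⟩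
  refine ⟨μ, hμl1, fun i => ?_, fun k => ?_⟩
  · have h1 : ∑' j, μ (j + (i + 1)) ≤ 2 * T i :=
      Real.tsum_le_of_sum_range_le (fun _ => hμ0 _) (hpart i)
    unfold seqAmInfty
    rw [← mul_div_assoc]
    gcongr
  · have h1 := (hsum (n k)).le_tsum k fun l _ => by split_ifs; exacts [ha0 _, le_rfl]
    simpa using h1

end Sequences

/-! ### Am-∞ closed ideals and the diagonal argument -/

section AmInfty

variable {H : Type*} [NormedAddCommGroup H] [InnerProductSpace ℂ H] [CompleteSpace H]
  {I J : TwoSidedIdeal (H →L[ℂ] H)} {X : H →L[ℂ] H}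

lemma isCharSet_preAmInfty (hH : ¬ FiniteDimensional ℂ H) (hI : I ≠ ⊥) :
    IsCharSet {ξ | ξ ∈ l1Star ∧ seqAmInfty ξ ∈ charSet I} where
  subset _ h := l1Star_subset_c0Star h.1
  zero_mem := ⟨zero_mem_l1Star, by
    rw [seqAmInfty_zero]; exact (isCharSet_charSet hH I).zero_mem⟩
  add_mem := by
    rintro ξ η ⟨hξ, hξ'⟩ ⟨hη, hη'⟩
    refine ⟨add_mem_l1Star hξ hη, ?_⟩
    rw [seqAmInfty_add hξ hη]
    exact (isCharSet_charSet hH I).add_mem hξ' hη'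
  of_dominated := by
    rintro ξ η hξ ⟨hη, -, X, hX, hXη⟩ h
    have hξ1 := h.eventuallyDominated.mem_l1Star hξ.1 (nonneg_of_mem_c0Star hξ) hη
    refine ⟨hξ1, mem_charSet_of_eventuallyDominated hH hI hX (seqAmInfty_mem_c0Star hξ1) ?_⟩
    rw [hXη]
    exact h.eventuallyDominated.seqAmInfty hξ1 hη

lemma isCharSet_amInfty (hH : ¬ FiniteDimensional ℂ H) (J : TwoSidedIdeal (H →L[ℂ] H)) :
    IsCharSet {ξ | ξ ∈ c0Star ∧ ∃ η ∈ charSet J ∩ l1Star, ξ =O[atTop] seqAmInfty η} where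
  subset _ h := h.1
  zero_mem := ⟨l1Star_subset_c0Star zero_mem_l1Star, 0,
    ⟨(isCharSet_charSet hH J).zero_mem, zero_mem_l1Star⟩, isBigO_zero _ _⟩
  add_mem := by
    rintro ξ ξ' ⟨hξ, η, ⟨hη, hη1⟩, hO⟩ ⟨hξ', η', ⟨hη', hη1'⟩, hO'⟩
    refine ⟨⟨hξ.1.add hξ'.1, ?_⟩, η + η',
      ⟨(isCharSet_charSet hH J).add_mem hη hη', add_mem_l1Star hη1 hη1'⟩, ?_⟩
    · rw [← add_zero (0 : ℝ)]
      exact hξ.2.add hξ'.2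
    · have h0 := seqAmInfty_nonneg hη1
      have h0' := seqAmInfty_nonneg hη1'
      rw [seqAmInfty_add hη1 hη1']
      refine (hO.trans (IsBigO.of_norm_le fun n => ?_)).add
        (hO'.trans (IsBigO.of_norm_le fun n => ?_))
      · rw [Real.norm_of_nonneg (h0 n)]
        exact le_add_of_nonneg_right (h0' n)
      · rw [Real.norm_of_nonneg (h0' n)]
        exact le_add_of_nonneg_left (h0 n)
  of_dominated := by
    rintro ξ ζ hξ ⟨hζ, η, ⟨hη, hη1⟩, hO⟩ ⟨m, hm, C, hC, hk⟩
    have hA := ampliation_mem_l1Star hm hη1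
    refine ⟨hξ, ampliation m η, ⟨(isCharSet_charSet hH J).of_dominated
      (l1Star_subset_c0Star hA) hη (dominated_ampliation hm η), hA⟩, ?_⟩
    have h1 : ξ =O[atTop] fun n => ζ (n / m) := IsBigO.of_bound C <| Eventually.of_forall fun n => by
      rw [Real.norm_of_nonneg (nonneg_of_mem_c0Star hξ n),
        Real.norm_of_nonneg (nonneg_of_mem_c0Star hζ _)]
      exact (hξ.1 (Nat.mul_div_le n m)).trans (hk _)
    have h2 : (fun n => ζ (n / m)) =O[atTop] fun n => seqAmInfty η (n / m) :=
      hO.comp_tendsto (Nat.tendsto_div_const_atTop hm.ne')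
    refine (h1.trans h2).trans (IsBigO.of_norm_le fun n => ?_)
    rw [Real.norm_of_nonneg (seqAmInfty_nonneg hη1 _)]
    exact seqAmInfty_div_le hm hη1 n

lemma mem_preAmInfty_iff (hH : ¬ FiniteDimensional ℂ H) (hI : I ≠ ⊥) :
    X ∈ preAmInfty I ↔ sNumbers X ∈ l1Star ∧ seqAmInfty (sNumbers X) ∈ charSet I :=
  mem_idealOfCharSet_iff (isCharSet_preAmInfty hH hI)

lemma charSet_preAmInfty (hH : ¬ FiniteDimensional ℂ H) (hI : I ≠ ⊥) :
    charSet (preAmInfty I) = {ξ | ξ ∈ l1Star ∧ seqAmInfty ξ ∈ charSet I} :=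
  charSet_idealOfCharSet hH (isCharSet_preAmInfty hH hI)

lemma charSet_amInfty (hH : ¬ FiniteDimensional ℂ H) (J : TwoSidedIdeal (H →L[ℂ] H)) :
    charSet (amInfty J) =
      {ξ | ξ ∈ c0Star ∧ ∃ η ∈ charSet J ∩ l1Star, ξ =O[atTop] seqAmInfty η} :=
  charSet_idealOfCharSet hH (isCharSet_amInfty hH J)

/-- Since `O` is taken at infinity, every eventually zero sequence of `c₀*` is `O(0)`; so the mean
is nonzero even for `J = ⊥`. -/
lemma amInfty_ne_bot (hH : ¬ FiniteDimensional ℂ H) (J : TwoSidedIdeal (H →L[ℂ] H)) :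
    amInfty J ≠ ⊥ := by
  intro h
  let δ : ℕ → ℝ := fun n => if n = 0 then 1 else 0
  have hδ0 : δ =ᶠ[atTop] 0 := by
    filter_upwards [eventually_gt_atTop 0] with n hn
    simp [δ, hn.ne']
  have hδ : δ ∈ charSet (amInfty J) := by
    rw [charSet_amInfty hH]
    refine ⟨⟨fun i j hij => ?_, tendsto_const_nhds.congr' hδ0.symm⟩, 0,
      ⟨(isCharSet_charSet hH J).zero_mem, zero_mem_l1Star⟩, hδ0.trans_isBigO (isBigO_zero _ _)⟩
    rcases i.eq_zero_or_pos with rfl | hi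
    · simp only [δ]; split_ifs <;> norm_num
    · simp [δ, hi.ne', (hi.trans_le hij).ne']
  obtain ⟨-, X, hX, hXδ⟩ := hδ
  rw [h, TwoSidedIdeal.mem_bot] at hX
  have := congrFun hXδ 0
  simp [hX, δ] at this

lemma mem_amInftyClosure_iff (hH : ¬ FiniteDimensional ℂ H) :
    X ∈ amInftyClosure J ↔ sNumbers X ∈ l1Star ∧
      ∃ η ∈ charSet J ∩ l1Star, seqAmInfty (sNumbers X) =O[atTop] seqAmInfty η := by
  rw [amInftyClosure, mem_preAmInfty_iff hH (amInfty_ne_bot hH J), charSet_amInfty hH]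
  exact ⟨fun h => ⟨h.1, h.2.2⟩, fun h => ⟨h.1, seqAmInfty_mem_c0Star h.1, h.2⟩⟩

lemma preAmInfty_le (hH : ¬ FiniteDimensional ℂ H) (hI : I ≠ ⊥) : preAmInfty I ≤ I := by
  intro X hX
  obtain ⟨h1, -, Y, hY, hYX⟩ := (mem_preAmInfty_iff hH hI).1 hX
  refine mem_of_sNumbers_mem_charSet hH (mem_charSet_of_eventuallyDominated hH hI hY
    (l1Star_subset_c0Star h1) ?_)
  rw [hYX]
  exact eventuallyDominated_seqAmInfty h1

lemma mem_charSet_of_isBigO (hH : ¬ FiniteDimensional ℂ H) (hI : I ≠ ⊥) {ξ η : ℕ → ℝ}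
    (hξ : ξ ∈ c0Star) (hη : η ∈ charSet I) (h : ξ =O[atTop] η) : ξ ∈ charSet I := by
  obtain ⟨-, X, hX, rfl⟩ := hη
  obtain ⟨C, hC, hb⟩ := h.exists_nonneg
  refine mem_charSet_of_eventuallyDominated hH hI hX hξ ⟨1, one_pos, C, hC, ?_⟩
  filter_upwards [hb.bound] with n hn
  rw [one_mul]
  rw [Real.norm_of_nonneg (sNumbers_nonneg X n)] at hn
  exact (Real.le_norm_self _).trans hn

/-- One inclusion takes `η = s(X)`. For the other, `η` in the characteristic set of `preAmInfty I`
means `η_{a∞} ∈ Σ(I)`, which absorbs anything that is `O(η_{a∞})`. -/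
lemma isAmInftyClosed_preAmInfty (hH : ¬ FiniteDimensional ℂ H) (hI : I ≠ ⊥) :
    IsAmInftyClosed (preAmInfty I) := by
  refine TwoSidedIdeal.ext fun X => ?_
  rw [mem_amInftyClosure_iff hH]
  constructor
  · intro hX
    have h := (mem_preAmInfty_iff hH hI).1 hX
    exact ⟨h.1, _, ⟨⟨l1Star_subset_c0Star h.1, X, hX, rfl⟩, h.1⟩, isBigO_refl _ _⟩
  · rintro ⟨h1, η, ⟨hη, hη1⟩, hO⟩
    rw [charSet_preAmInfty hH hI] at hη
    exact (mem_preAmInfty_iff hH hI).2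
      ⟨h1, mem_charSet_of_isBigO hH hI (seqAmInfty_mem_c0Star h1) hη.2 hO⟩

/-- If the characteristic set of a countably generated ideal contains every summable sequence whose
tail sums are controlled by those of `ξ`, then it contains the arithmetic mean at infinity
of `ξ`. -/
lemma seqAmInfty_mem_charSet (hH : ¬ FiniteDimensional ℂ H) (hI : I ≠ ⊥)
    (hcg : IsCountablyGenerated I) {ξ : ℕ → ℝ} (hξ : ξ ∈ l1Star)
    (h : ∀ μ ∈ l1Star, (∀ n, seqAmInfty μ n ≤ 2 * seqAmInfty ξ n) → μ ∈ charSet I) :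
    seqAmInfty ξ ∈ charSet I := by
  obtain ⟨G', hG', rfl⟩ := hcg
  have hne : G'.Nonempty := by
    rw [Set.nonempty_iff_ne_empty]
    rintro rfl
    exact hI (le_bot_iff.1 (TwoSidedIdeal.span_le.2 (Set.empty_subset _)))
  obtain ⟨G, rfl⟩ := hG'.exists_eq_range hne
  by_contra hnot
  have hc := seqAmInfty_mem_c0Star hξ
  -- Otherwise some bound holds eventually, and its right-hand side comes from the `s`-numbers of
  -- one operator of `I`, putting `seqAmInfty ξ` in the characteristic set.
  have hex : ∀ k N : ℕ, ∃ j ≥ N, ((k : ℝ) + 1) * ∑ i ∈ Finset.range (k + 1), sNumbers (G i) j <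
      seqAmInfty ξ ((k + 1) * j) := by
    by_contra! hcon
    obtain ⟨k, N, hkN⟩ := hcon
    obtain ⟨Y, hY, hYs⟩ := exists_mem_sNumbers_eq_sum (I := TwoSidedIdeal.span (Set.range G)) hH
      (Finset.range (k + 1)) (G := G) fun i _ => TwoSidedIdeal.subset_span ⟨i, rfl⟩
    refine hnot (mem_charSet_of_eventuallyDominated hH hI hY hc
      ⟨k + 1, k.succ_pos, (k : ℝ) + 1, by positivity, eventually_atTop.2 ⟨N, fun j hj => ?_⟩⟩)
    rw [hYs, Finset.sum_apply]
    exact hkN j hj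
  have hρ : ∀ k j : ℕ, 0 ≤ ((k : ℝ) + 1) * ∑ i ∈ Finset.range (k + 1), sNumbers (G i) j :=
    fun k j => mul_nonneg (by positivity) (Finset.sum_nonneg fun i _ => sNumbers_nonneg _ _)
  -- A strict violation at arbitrarily large indices prevents the tails of `ξ` from vanishing, so
  -- they can be halved repeatedly.
  have hTpos : ∀ n, 0 < ∑' j, ξ (j + n) := fun n => by
    obtain ⟨j, hj, hlt⟩ := hex 0 n
    have h1 := (hρ 0 j).trans_lt hlt
    refine (h1.trans_le (seqAmInfty_le_tail hξ _)).trans_le (tail_antitone hξ ?_)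
    omega
  let P : ℕ → ℕ → Prop := fun k n => ∃ j, n = (k + 1) * j ∧
    ((k : ℝ) + 1) * ∑ i ∈ Finset.range (k + 1), sNumbers (G i) j < seqAmInfty ξ n
  have hstep : ∀ k n₀ : ℕ, ∃ n > n₀, P k n ∧
      ∑' j, ξ (j + (n + 1)) ≤ (∑' j, ξ (j + (n₀ + 1))) / 2 := by
    intro k n₀
    obtain ⟨N, hN⟩ := eventually_atTop.1
      ((tail_tendsto_zero ξ).eventually_lt_const (half_pos (hTpos (n₀ + 1))))
    obtain ⟨j, hj, hlt⟩ := hex k (N + n₀ + 1)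
    have hjk : j ≤ (k + 1) * j := Nat.le_mul_of_pos_left j k.succ_pos
    exact ⟨(k + 1) * j, by omega, ⟨j, rfl, hlt⟩, (hN _ (by omega)).le⟩
  choose f hf hfP hfT using hstep
  let n : ℕ → ℕ := fun k => Nat.rec (f 0 0) (fun k m => f (k + 1) m) k
  have hnP : ∀ k, P k (n k) := fun k => by
    cases k with
    | zero => exact hfP 0 0
    | succ k => exact hfP (k + 1) (n k)
  obtain ⟨μ, hμ, hμξ, hμn⟩ := exists_step_sequence hξ (n := n)
    (strictMono_nat_of_lt_succ fun k => hf (k + 1) (n k)) fun k => hfT (k + 1) (n k)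
  obtain ⟨-, X, hX, rfl⟩ := h μ hμ hμξ
  -- The `k` bounding `X` is the stage at which `n k` was chosen to violate that same bound.
  obtain ⟨k, hk⟩ := exists_sNumbers_le_of_mem_span hX
  obtain ⟨j, hj, hlt⟩ := hnP k
  have h1 := hμn k
  rw [hj] at h1 hlt
  exact absurd (hk j) (not_le.2 (hlt.trans_le h1))

/-- Closedness of `J` supplies the hypothesis of `seqAmInfty_mem_charSet`: if `μ_{a∞} ≤ 2 s(X)_{a∞}`
with `X ∈ J`, then `μ ∈ Σ(J) ⊆ Σ(I)`. -/
lemma le_preAmInfty_of_isAmInftyClosed (hH : ¬ FiniteDimensional ℂ H) (hI : I ≠ ⊥)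
    (hcg : IsCountablyGenerated I) (hJ : IsAmInftyClosed J) (hJI : J ≤ I) : J ≤ preAmInfty I := by
  intro X hX
  have hX' := hX
  rw [hJ] at hX'
  have h1 := ((mem_amInftyClosure_iff hH).1 hX').1
  refine (mem_preAmInfty_iff hH hI).2 ⟨h1, seqAmInfty_mem_charSet hH hI hcg h1 fun μ hμ hle => ?_⟩
  have hne := amInfty_ne_bot hH J
  have hμJ : μ ∈ charSet J := by
    rw [hJ, amInftyClosure, charSet_preAmInfty hH hne, charSet_amInfty hH]
    refine ⟨hμ, seqAmInfty_mem_c0Star hμ, sNumbers X, ⟨⟨l1Star_subset_c0Star h1, X, hX, rfl⟩, h1⟩,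
      IsBigO.of_bound 2 (Eventually.of_forall fun n => ?_)⟩
    rw [Real.norm_of_nonneg (seqAmInfty_nonneg hμ n), Real.norm_of_nonneg (seqAmInfty_nonneg h1 n)]
    exact hle n
  obtain ⟨hc, Y, hY, hYμ⟩ := hμJ
  exact ⟨hc, Y, hJI hY, hYμ⟩

end AmInfty

end OperatorIdeal

theorem theorem3p4 {H : Type*} [NormedAddCommGroup H] [InnerProductSpace ℂ H] [CompleteSpace H]
    [TopologicalSpace.SeparableSpace H] (hH : ¬ FiniteDimensional ℂ H)
    (I : TwoSidedIdeal (H →L[ℂ] H)) (hI : I ≠ ⊥)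
    (hcg : OperatorIdeal.IsCountablyGenerated I) :
    OperatorIdeal.amInftyLower I = (OperatorIdeal.preAmInfty I : Set (H →L[ℂ] H)) ∧
    IsGreatest {J : TwoSidedIdeal (H →L[ℂ] H) | OperatorIdeal.IsAmInftyClosed J ∧ J ≤ I}
      (OperatorIdeal.preAmInfty I) ∧
    (OperatorIdeal.IsAmInftyClosed I ↔ OperatorIdeal.IsAmInftyStable I) := by
  have hle := OperatorIdeal.preAmInfty_le hH hI
  have hcl := OperatorIdeal.isAmInftyClosed_preAmInfty hH hI
  have hmax : ∀ {J}, OperatorIdeal.IsAmInftyClosed J → J ≤ I → J ≤ OperatorIdeal.preAmInfty I :=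
    OperatorIdeal.le_preAmInfty_of_isAmInftyClosed hH hI hcg
  refine ⟨Set.Subset.antisymm (Set.iUnion₂_subset fun J hJ => hmax hJ.2 hJ.1)
    (Set.subset_iUnion₂_of_subset (OperatorIdeal.preAmInfty I) ⟨hle, hcl⟩ subset_rfl),
    ⟨⟨hcl, hle⟩, fun J hJ => hmax hJ.1 hJ.2⟩,
    fun h => le_antisymm (hmax h le_rfl) hle, fun h => ?_⟩
  rw [h]
  exact hcl
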